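/- Let $G=\langle a,b\rangle$ be the free group of rank $2$ and let $\mu$ be the uniform probability measure on $\{a,b,a^{-1},b^{-1}\}$. Let $\mathrm{Sub}_G\subset\{0,1\}^G$ be the compact space of subgroups of $G$, and let $\mathcal M(\mathrm{Sub}_G)$ be the set of conjugation-invariant Borel probability measures on it, with the weak* topology. For a subgroup $K$, the Schreier coset graph has vertex set $K\backslash G$ and edges from $Kg$ to $Kga$ and to $Kgb$ for each coset $Kg$. Call $K\backslash G$ *tree-like* if this graph becomes a tree when loops are deleted and multiple edges are identified (equivalently, it has no simple circuit of length greater than $2$). Let $\mathrm{Tree}_G\subset \mathrm{Sub}_G$ be the (closed) set of such $K$, and let $\mathcal M(\mathrm{Tree}_G)$ be the set of $\lambda\in\mathcal M(\mathrm{Sub}_G)$ with $\lambda(\mathrm{Tree}_G)=1$. Let $X_1,X_2,\dots$ be i.i.d. with law $\mu$, $Z_n=X_1\cdots X_n$ and $Z_0=e$. Let $R_{\ge n}(\mu,K)$ be the probability that $KZ_m=K$ for some $m\ge n$. A set $\mathcal N\subset\mathcal M(\mathrm{Sub}_G)$ has *controlled return-time probabilities* if $$\lim_{n\to\infty}\ \sup_{\eta\in\mathcal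 N}\ \eta\bigl(\{K\in \mathrm{Sub}_G: R_{\ge n}(\mu,K)\ge\epsilon\}\bigr)=0\qquad\text{for every }\epsilon>0 .$$ For $\lambda\in\mathcal M(\mathrm{Sub}_G)$ let $\mathbb P_\lambda$ be the law of $(K;KZ_0,KZ_1,KZ_2,\dots)$, where $K$ has law $\lambda$ and is independent of $(X_i)$. It is a measure on the space of all $(K;Kg_0,Kg_1,\dots)$ with $K\in\mathrm{Sub}_G$ and $g_i\in G$. On this space $G$ acts by $\gamma(K;Kg_0,Kg_1,\dots)=(\gamma K\gamma^{-1};\gamma Kg_0,\gamma Kg_1,\dots)$, and this action commutes with the time shift $(K;Kg_0,Kg_1,\dots)\mapsto(K;Kg_1,Kg_2,\dots)$. The *Poisson boundary* $(B(\mathrm{Sub}_G),\nu_\lambda)$ is a space with a measurable $G$-action and a $G$-equivariant measurable map $\mathbf{bnd}$ from the path space such that $\mathbf{bnd}_*\mathbb P_\lambda=\nu_\lambda$ and the preimages under $\mathbf{bnd}$ of measurable sets are exactly the shift-invariant Borel sets. Equivariance and the description of preimages are understood modulo sets all of whose $G$-translates are $\mathbb P_\lambda$-null. Let $$h_\mu(\lambda)=\sum_{g\in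 G}\mu(g)\int-\log\frac{d(\nu_\lambda\circ g)}{d\nu_\lambda}\,d\nu_\lambda ,\qquad (\nu_\lambda\circ g)(E)=\nu_\lambda(gE),$$ be the Furstenberg entropy of the Poisson boundary. **Theorem.** If $\mathcal N\subset\mathcal M(\mathrm{Tree}_G)$ has controlled return-time probabilities, then $h_\mu(\lambda)$ is well defined and finite for every $\lambda\in\mathcal N$ (for $\mu$-a.e. $g$, $\nu_\lambda\circ g\ll\nu_\lambda$ and $\log\frac{d(\nu_\lambda\circ g)}{d\nu_\lambda}$ is $\nu_\lambda$-integrable), and the function $\lambda\mapsto h_\mu(\lambda)$ is continuous on $\mathcal N$ in the weak* topology. This holds for every choice of realizations of the Poisson boundaries. -/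

import Mathlib

open MeasureTheory Filter Topology Pointwise

noncomputable section

namespace RandomCosetWalk

/-! ### Furstenberg entropy of a measure on a `Γ`-space -/

section Entropy

variable {Γ X : Type*} [Group Γ] [MeasurableSpace Γ] [MulAction Γ X] [MeasurableSpace X]

/-- `x ↦ - log (d(η ∘ g)/dη) (x)`. The measure `η ∘ g : E ↦ η (g E)` is the image of `η`
under `g⁻¹`. -/
def entropyIntegrand (η : Measure X) (g : Γ) (x : X) : ℝ :=
  -Real.log ((η.map (fun y => g⁻¹ • y)).rnDeriv η x).toReal

/-- The Furstenberg entropy (`μ`-entropy)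
`h_μ(X, η) = ∬ - log (d(η ∘ g)/dη) (x) dη(x) dμ(g)`. -/
def furstenbergEntropy (μ : Measure Γ) (η : Measure X) : ℝ :=
  ∫ g, ∫ x, entropyIntegrand η g x ∂η ∂μ

/-- The double integral defining `h_μ(X, η)` makes sense and is finite: for `μ`-almost every `g`
the measure `η ∘ g` has a density with respect to `η` whose logarithm is `η`-integrable, and the
inner integrals form a `μ`-integrable function. -/
def FurstenbergEntropyDefined (μ : Measure Γ) (η : Measure X) : Prop :=
  (∀ᵐ g ∂μ, η.map (fun y => g⁻¹ • y) ≪ η ∧ Integrable (entropyIntegrand η g) η) ∧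
    Integrable (fun g => ∫ x, entropyIntegrand η g x ∂η) μ

end Entropy

/-! ### The free group of rank two and the simple random walk -/

/-- The free group `⟨a, b⟩` of rank two. -/
abbrev F₂ : Type := FreeGroup (Fin 2)

/-- The first free generator. -/
def a : F₂ := FreeGroup.of 0

/-- The second free generator. -/
def b : F₂ := FreeGroup.of 1

/-- `F₂` is a discrete group: every subset is Borel. -/
instance : MeasurableSpace F₂ := ⊤

instance : DiscreteMeasurableSpace F₂ := ⟨fun _ => trivial⟩

/-- The symmetric generating set `{a, b, a⁻¹, b⁻¹}`. -/
def gens : Finset F₂ := {a, b, a⁻¹, b⁻¹}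

/-- The uniform probability measure `μ` on `{a, b, a⁻¹, b⁻¹}`. -/
def stepMeasure : Measure F₂ :=
  (PMF.uniformOfFinset gens ⟨a, Finset.mem_insert_self _ _⟩).toMeasure

instance : IsProbabilityMeasure stepMeasure := by
  unfold stepMeasure; infer_instance

/-- The law of the sequence of increments `X₁, X₂, …`, i.i.d. with law `μ`
(the increment `Xₙ₊₁` is the coordinate with index `n`). -/
def incrementLaw : Measure (ℕ → F₂) := Measure.infinitePi (fun _ : ℕ => stepMeasure)

instance : IsProbabilityMeasure incrementLaw := by
  unfold incrementLaw; infer_instance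

/-- The position `Zₙ = X₁ X₂ ⋯ Xₙ` of the walk, `Z₀ = 1`. -/
def walk (X : ℕ → F₂) : ℕ → F₂
  | 0 => 1
  | n + 1 => walk X n * X n

/-! ### The space of subgroups and invariant random subgroups -/

/-- The indicator function of a subgroup, as an element of `{0, 1}^G`. -/
def subgroupIndicator (K : Subgroup F₂) (g : F₂) : Bool :=
  haveI := Classical.propDecidable (g ∈ K)
  decide (g ∈ K)

/-- The space of subgroups of the discrete group `F₂`, with the topology of uniform convergence
on compact (that is, finite) sets, i.e. the subspace topology from `{0, 1}^G`. -/
instance : TopologicalSpace (Subgroup F₂) :=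
  TopologicalSpace.induced subgroupIndicator inferInstance

instance : MeasurableSpace (Subgroup F₂) := borel _

instance : BorelSpace (Subgroup F₂) := ⟨rfl⟩

/-- `η` is invariant under conjugation, i.e. it is the law of an invariant random subgroup. -/
def IsConjInvariant (η : ProbabilityMeasure (Subgroup F₂)) : Prop :=
  ∀ γ : F₂, (η : Measure (Subgroup F₂)).map (fun K => MulAut.conj γ • K) = η

/-- The set `K \ G` of right cosets `K g`. -/
abbrev RightCosets (K : Subgroup F₂) : Type := Quotient (QuotientGroup.rightRel K)

/-- The right coset `K g`. -/
def rightCoset (K : Subgroup F₂) (g : F₂) : RightCosets K := Quotient.mk _ g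

/-- The simple graph underlying the Schreier coset graph of `K \ G`: its edges are
`{K g, K g a}` and `{K g, K g b}`, where loops are discarded and multiple edges identified. -/
def schreierGraph (K : Subgroup F₂) : SimpleGraph (RightCosets K) :=
  SimpleGraph.fromRel fun x y =>
    ∃ g : F₂, x = rightCoset K g ∧ (y = rightCoset K (g * a) ∨ y = rightCoset K (g * b))

/-- `K \ G` is tree-like: any two vertices of the Schreier coset graph are joined by a unique
sequence of vertices in which consecutive vertices are adjacent and distinct and which does not
backtrack. Loops and multiple edges are allowed; only simple circuits of length greater
than `2` are excluded. -/
def TreeLike (K : Subgroup F₂) : Prop := (schreierGraph K).IsTree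

/-- `R_{≥ n}(μ, K)`: the probability that `K X₁ ⋯ Xₘ = K` for some `m ≥ n`. -/
def returnProbGE (n : ℕ) (K : Subgroup F₂) : ℝ :=
  incrementLaw.real {X | ∃ m, n ≤ m ∧ walk X m ∈ K}

/-- Controlled return-time probabilities:
`lim_{n → ∞} sup_{η ∈ 𝒩} η {K : R_{≥ n}(μ, K) ≥ ε} = 0` for every `ε > 0`. -/
def ControlledReturnTimes (𝒩 : Set (ProbabilityMeasure (Subgroup F₂))) : Prop :=
  ∀ ε : ℝ, 0 < ε →
    Tendsto
      (fun n : ℕ => ⨆ η ∈ 𝒩, (η : Measure (Subgroup F₂)) {K | ε ≤ returnProbGE n K})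
      atTop (𝓝 0)

/-! ### Trajectories in random coset spaces -/

/-- The space of all `(K; K g₀, K g₁, K g₂, …)` with `K` a subgroup of `F₂` and `gₙ ∈ F₂`, a
subset of `Sub_G × (2^G)^ℕ`. -/
def CosetPath : Type :=
  {p : Subgroup F₂ × (ℕ → Set F₂) // ∀ n, ∃ g : F₂, p.2 n = MulOpposite.op g • (p.1 : Set F₂)}

/-- The Borel structure, induced from `Sub_G × (2^G)^ℕ`. -/
instance : MeasurableSpace CosetPath :=
  inferInstanceAs (MeasurableSpace {p : Subgroup F₂ × (ℕ → Set F₂) //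
    ∀ n, ∃ g : F₂, p.2 n = MulOpposite.op g • (p.1 : Set F₂)})

namespace CosetPath

/-- The time shift `(K; K g₀, K g₁, …) ↦ (K; K g₁, K g₂, …)`. -/
def shift (x : CosetPath) : CosetPath :=
  ⟨(x.1.1, fun n => x.1.2 (n + 1)), fun n => x.2 (n + 1)⟩

/-- The path `(K; K g₀, K g₁, …)` given by `K` and `g₀, g₁, …`. -/
def mk (K : Subgroup F₂) (g : ℕ → F₂) : CosetPath :=
  ⟨(K, fun n => MulOpposite.op (g n) • (K : Set F₂)), fun n => ⟨g n, rfl⟩⟩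

/-- The action `γ (K; K g₀, K g₁, …) = (γ K γ⁻¹; γ K g₀, γ K g₁, …)`. -/
instance : SMul F₂ CosetPath where
  smul γ x := ⟨(MulAut.conj γ • x.1.1, fun n => γ • x.1.2 n), by
    intro n
    obtain ⟨g, hg⟩ := x.2 n
    refine ⟨γ * g, ?_⟩
    ext h
    simp only [hg, Set.mem_smul_set_iff_inv_smul_mem, ← MulOpposite.op_inv,
      MulOpposite.smul_eq_mul_unop, MulOpposite.unop_op, SetLike.mem_coe, smul_eq_mul,
      Subgroup.mem_pointwise_smul_iff_inv_smul_mem, MulAut.smul_def, ← map_inv,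
      MulAut.conj_apply]
    simp [mul_assoc]⟩

theorem smul_fst (γ : F₂) (x : CosetPath) : (γ • x).1.1 = MulAut.conj γ • x.1.1 := rfl

theorem smul_snd (γ : F₂) (x : CosetPath) : (γ • x).1.2 = fun n => γ • x.1.2 n := rfl

instance : MulAction F₂ CosetPath where
  one_smul x := by
    apply Subtype.ext
    apply Prod.ext
    · rw [smul_fst, map_one, one_smul]
    · rw [smul_snd]; funext n; exact one_smul _ _
  mul_smul γ δ x := by
    apply Subtype.ext
    apply Prod.ext
    · rw [smul_fst, smul_fst, smul_fst, map_mul, mul_smul]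
    · rw [smul_snd, smul_snd, smul_snd]; funext n; exact mul_smul _ _ _

end CosetPath

theorem measurableSet_mem_subgroup (g : F₂) : MeasurableSet {K : Subgroup F₂ | g ∈ K} := by
  have hc : Continuous fun K : Subgroup F₂ => subgroupIndicator K g :=
    (continuous_apply (A := fun _ : F₂ => Bool) g).comp
      (continuous_induced_dom (f := subgroupIndicator))
  have : {K : Subgroup F₂ | g ∈ K} = (fun K => subgroupIndicator K g) ⁻¹' {true} := by
    ext K; simp [subgroupIndicator]
  rw [this]
  exact ((isOpen_discrete _).preimage hc).measurableSet

theorem measurable_conj (γ : F₂) :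
    Measurable (fun K : Subgroup F₂ => MulAut.conj γ • K) := by
  refine Continuous.measurable
    (continuous_induced_rng (f := subgroupIndicator).2 (continuous_pi fun g => ?_))
  have : (fun K : Subgroup F₂ => (subgroupIndicator ∘ fun K => MulAut.conj γ • K) K g)
      = fun K => subgroupIndicator K (γ⁻¹ * g * γ) := by
    funext K
    simp [subgroupIndicator, Subgroup.mem_pointwise_smul_iff_inv_smul_mem, ← map_inv]
  rw [this]
  exact (continuous_apply (A := fun _ : F₂ => Bool) (γ⁻¹ * g * γ)).comp
    (continuous_induced_dom (f := subgroupIndicator))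

theorem measurable_smul_cosetPath (γ : F₂) : Measurable (fun x : CosetPath => γ • x) := by
  refine Measurable.subtype_mk (Measurable.prodMk ?_ ?_)
  · exact (measurable_conj γ).comp (measurable_fst.comp measurable_subtype_coe)
  · refine measurable_pi_lambda _ fun n => measurable_set_iff.2 fun g => ?_
    have h : Measurable fun x : CosetPath => x.1.2 n :=
      (measurable_pi_apply n).comp (measurable_snd.comp measurable_subtype_coe)
    have h2 := measurable_set_iff.1 h (γ⁻¹ * g)
    have : (fun x : CosetPath => g ∈ γ • x.1.2 n) = fun x => γ⁻¹ * g ∈ x.1.2 n := by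
      funext x; rw [Set.mem_smul_set_iff_inv_smul_mem]; rfl
    rw [this]; exact h2

theorem measurable_shift : Measurable CosetPath.shift := by
  refine Measurable.subtype_mk (Measurable.prodMk ?_ ?_)
  · exact measurable_fst.comp measurable_subtype_coe
  · exact measurable_pi_lambda _ fun n =>
      (measurable_pi_apply (n + 1)).comp (measurable_snd.comp measurable_subtype_coe)

theorem measurable_walk (n : ℕ) : Measurable fun X : ℕ → F₂ => walk X n := by
  induction n with
  | zero => exact measurable_const
  | succ n ih =>
    have h : Measurable fun p : F₂ × F₂ => p.1 * p.2 := Measurable.of_discrete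
    exact h.comp (ih.prodMk (measurable_pi_apply n))

/-- The map sending `(K, (X₁, X₂, …))` to the trajectory `(K; K, K X₁, K X₁ X₂, …)`. -/
def cosetWalk (p : Subgroup F₂ × (ℕ → F₂)) : CosetPath := CosetPath.mk p.1 (walk p.2)

theorem measurable_cosetWalk : Measurable cosetWalk := by
  refine Measurable.subtype_mk (Measurable.prodMk measurable_fst ?_)
  refine measurable_pi_lambda _ fun n => measurable_set_iff.2 fun g => ?_
  refine measurableSet_setOfPred.1 ?_
  have : {p : Subgroup F₂ × (ℕ → F₂) | g ∈ MulOpposite.op (walk p.2 n) • (p.1 : Set F₂)}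
      = ⋃ z : F₂, (Prod.snd ⁻¹' {X | walk X n = z}) ∩ (Prod.fst ⁻¹' {K | g * z⁻¹ ∈ K}) := by
    ext p
    simp [Set.mem_smul_set_iff_inv_smul_mem, ← MulOpposite.op_inv]
  rw [this]
  refine MeasurableSet.iUnion fun z => ?_
  exact (measurable_snd (measurable_walk n (measurableSet_singleton z))).inter
    (measurable_fst (measurableSet_mem_subgroup _))

/-- The law `ℙ_η` of `(K; K Z₀, K Z₁, K Z₂, …)`, where `K` has law `η` and is independent of the
walk. -/
def pathLaw (η : ProbabilityMeasure (Subgroup F₂)) : Measure CosetPath :=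
  ((η : Measure (Subgroup F₂)).prod incrementLaw).map cosetWalk

instance (η : ProbabilityMeasure (Subgroup F₂)) : IsProbabilityMeasure (pathLaw η) :=
  Measure.isProbabilityMeasure_map measurable_cosetWalk.aemeasurable

/-! ### The Poisson boundary -/

/-- A realization of the Poisson boundary `(B(Sub_G), ν_η)`: a space on which `G` acts by
measurable maps, together with a `G`-equivariant measurable map `bnd` from the path space such
that the sets `bnd⁻¹ E` are, modulo null sets, exactly the shift-invariant sets. The boundary
measure is the image of `ℙ_η` under `bnd`.

"Modulo null sets" refers to the smallest `G`-invariant measure class containing `ℙ_η`: a set of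
paths is negligible if all its translates are `ℙ_η`-null. (`ℙ_η` itself is not quasi-invariant,
since it is carried by paths with `K g₀ = K`, and neglecting all `ℙ_η`-null sets would leave the
action of `G` on the boundary undetermined.)

The space need not be standard Borel; realizations by standard Borel spaces are included. That
`G` preserves the measure class of the boundary measure is a consequence of the conditions. -/
structure PoissonBoundary (η : ProbabilityMeasure (Subgroup F₂)) where
  /-- the underlying space -/
  carrier : Type*
  [measurableSpace : MeasurableSpace carrier]
  [mulAction : MulAction F₂ carrier]
  /-- each group element acts measurably -/
  measurable_smul : ∀ γ : F₂, Measurable fun ξ : carrier => γ • ξ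
  /-- the boundary map -/
  bnd : CosetPath → carrier
  measurable_bnd : Measurable bnd
  /-- the boundary map is equivariant off a negligible set -/
  bnd_smul : ∀ γ δ : F₂, ∀ᵐ x ∂(pathLaw η), bnd (γ • (δ • x)) = γ • bnd (δ • x)
  /-- preimages of measurable sets are shift-invariant, modulo negligible sets -/
  preimage_invariant : ∀ E : Set carrier, MeasurableSet E →
    ∃ A : Set CosetPath, MeasurableSet[MeasurableSpace.invariants CosetPath.shift] A ∧
      ∀ δ : F₂, ∀ᵐ x ∂(pathLaw η), (bnd (δ • x) ∈ E ↔ δ • x ∈ A)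
  /-- shift-invariant measurable sets are preimages, modulo negligible sets -/
  exists_preimage : ∀ A : Set CosetPath,
    MeasurableSet[MeasurableSpace.invariants CosetPath.shift] A →
    ∃ E : Set carrier, MeasurableSet E ∧
      ∀ δ : F₂, ∀ᵐ x ∂(pathLaw η), (bnd (δ • x) ∈ E ↔ δ • x ∈ A)

attribute [instance] PoissonBoundary.measurableSpace PoissonBoundary.mulAction

/-- The boundary measure `ν_η = bnd_* ℙ_η`. -/
def PoissonBoundary.measure {η : ProbabilityMeasure (Subgroup F₂)} (B : PoissonBoundary η) :
    Measure B.carrier :=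
  (pathLaw η).map B.bnd

/-- The tautological realization of the Poisson boundary: the path space with the σ-algebra of
shift-invariant measurable sets. In particular, realizations exist. -/
def PoissonBoundary.tautological (η : ProbabilityMeasure (Subgroup F₂)) : PoissonBoundary η :=
  @PoissonBoundary.mk η CosetPath (MeasurableSpace.invariants CosetPath.shift) inferInstance
    (fun γ => by
      intro A hA
      exact ⟨measurable_smul_cosetPath γ hA.1, by
        conv_rhs => rw [← hA.2]
        rfl⟩)
    id
    (fun _ hA => hA.1)
    (fun _ _ => Eventually.of_forall fun _ => rfl)
    (fun E hE => ⟨E, hE, fun _ => Eventually.of_forall fun _ => Iff.rfl⟩)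
    (fun A hA => ⟨A, hA, fun _ => Eventually.of_forall fun _ => Iff.rfl⟩)

end RandomCosetWalk

end

namespace RandomCosetWalk

open scoped ENNReal

/-! ### The strong Markov property at first hitting times -/

/-! The entropy is a finite average, over generators `s`, of integrals of an explicit function of
`K`, and that function is a limit of continuous functions with error controlled by return
probabilities.

Fix `s ∈ gens` with `s ∉ K`. Since `K \ G` is tree-like, the edge between `K` and `K s` is a bridge.
A walk from `K` that ends on the far side must visit `K s`, and a walk from `K s` that does not end
there must visit `K`. By the strong Markov property, on shift-invariant events the walk from `K s`
has a density with respect to the walk from `K`: it is `(hitProb 1 s K)⁻¹` on `branchEvent s` and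
`hitProb s 1 K` off it (`lintegral_edgeDensity_fiber`). Conjugation invariance identifies the
translate of `pathLaw η` by `s` with the law of the walk from `K s`, so this density is the
Radon-Nikodym derivative on every realization of the boundary (`exists_map_eq_withDensity`). It lies
between 1/4 and 4, which gives finiteness, and integrating its logarithm gives `edgeEntropy`
(`furstenbergEntropy_eq`).

Stopping the walk at a finite time turns `edgeEntropy` into `edgeEntropyAt n`, which depends on
finitely many membership conditions on `K` and hence is continuous on the whole space of subgroups.
For tree-like `K` the two differ by at most `38 * returnProbGE n K` (`abs_edgeEntropy_sub_le`):
without a return to the root after time `n`, the walk cannot change sides any more, and a late visit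
to `K s` is likely to be followed by a return. Controlled return times make the convergence of the
integrals uniform on `𝒩`, and a uniform limit of continuous functions is continuous. -/

theorem stepMeasure_singleton {g : F₂} (hg : g ∈ gens) :
    stepMeasure {g} = (gens.card : ℝ≥0∞)⁻¹ := by
  rw [stepMeasure, PMF.toMeasure_apply_singleton _ _ (MeasurableSet.singleton g)]
  exact PMF.uniformOfFinset_apply_of_mem _ hg

/-- Every later estimate needs only this lower bound, so `Finset.card_le_four` suffices and
distinctness of the four generators need not be checked. -/
theorem quarter_le_stepMeasure {g : F₂} (hg : g ∈ gens) : 4⁻¹ ≤ stepMeasure {g} := by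
  rw [stepMeasure_singleton hg, ENNReal.inv_le_inv]
  exact_mod_cast Finset.card_le_four

theorem ae_mem_gens : ∀ᵐ g ∂stepMeasure, g ∈ gens := by
  rw [ae_iff, stepMeasure, PMF.toMeasure_apply_eq_zero_iff _ (MeasurableSet.of_discrete)]
  refine Set.disjoint_left.2 fun x hx h => h ?_
  exact (PMF.mem_support_uniformOfFinset_iff ⟨a, Finset.mem_insert_self _ _⟩ x).1 hx

theorem inv_mem_gens {g : F₂} (hg : g ∈ gens) : g⁻¹ ∈ gens := by
  simp only [gens, Finset.mem_insert, Finset.mem_singleton] at hg ⊢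
  rcases hg with rfl | rfl | rfl | rfl <;> simp

theorem measurePreserving_eval (n : ℕ) :
    MeasurePreserving (fun X : ℕ → F₂ => X n) incrementLaw stepMeasure :=
  measurePreserving_eval_infinitePi (fun _ : ℕ => stepMeasure) n

theorem ae_forall_mem_gens : ∀ᵐ X ∂incrementLaw, ∀ n, X n ∈ gens :=
  ae_all_iff.2 fun n => (measurePreserving_eval n).quasiMeasurePreserving.ae ae_mem_gens

/-- The sequence which follows the first sequence for `n` steps and then the second one. -/
def splice (n : ℕ) (p : (ℕ → F₂) × (ℕ → F₂)) : ℕ → F₂ :=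
  fun i => if i < n then p.1 i else p.2 (i - n)

theorem measurable_splice (n : ℕ) : Measurable (splice n) := by
  refine measurable_pi_lambda _ fun i => ?_
  unfold splice
  split_ifs <;> fun_prop

/-- Increments before and after a fixed time are independent. It is enough to compare boxes, and the
preimage of a box is a product of two boxes, one in each sequence. -/
theorem map_splice (n : ℕ) :
    (incrementLaw.prod incrementLaw).map (splice n) = incrementLaw := by
  refine Measure.eq_infinitePi _ fun s t ht => ?_
  classical
  rw [Measure.map_apply (measurable_splice n)
    (MeasurableSet.pi s.countable_toSet fun i _ => ht i)]
  have hpre : splice n ⁻¹' Set.pi s t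
      = Set.pi (s.filter (· < n) : Finset ℕ) t ×ˢ
        Set.pi ((s.filter (fun i => ¬ i < n)).image (· - n) : Finset ℕ) (fun i => t (i + n)) := by
    ext p
    simp only [Set.mem_preimage, Set.mem_pi, Finset.mem_coe, Set.mem_prod, Finset.mem_filter,
      Finset.mem_image, splice]
    constructor
    · intro h
      refine ⟨fun i hi => by simpa [hi.2] using h i hi.1, ?_⟩
      rintro _ ⟨i, hi, rfl⟩
      have := h i hi.1
      rw [if_neg hi.2] at this
      rwa [Nat.sub_add_cancel (not_lt.1 hi.2)]
    · rintro ⟨h1, h2⟩ i hi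
      split_ifs with h
      · exact h1 i ⟨hi, h⟩
      · have := h2 _ ⟨i, ⟨hi, h⟩, rfl⟩
        rwa [Nat.sub_add_cancel (not_lt.1 h)] at this
  rw [hpre, Measure.prod_prod, incrementLaw, Measure.infinitePi_pi _ (fun i _ => ht i),
    Measure.infinitePi_pi _ (fun i _ => ht _), Finset.prod_image,
    ← Finset.prod_filter_mul_prod_filter_not s (· < n)]
  · congr 1
    refine Finset.prod_congr rfl fun i hi => ?_
    rw [Nat.sub_add_cancel (not_lt.1 (Finset.mem_filter.1 hi).2)]
  · intro i hi j hj hij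
    simp only [Finset.coe_filter, Set.mem_ofPred_eq, not_lt] at hi hj
    dsimp only at hij
    omega

theorem walk_congr {n : ℕ} {X Y : ℕ → F₂} (h : ∀ i < n, X i = Y i) : walk X n = walk Y n := by
  induction n with
  | zero => rfl
  | succ n ih => rw [walk, walk, ih fun i hi => h i (by omega), h n (by omega)]

theorem walk_add (X : ℕ → F₂) (n i : ℕ) :
    walk X (n + i) = walk X n * walk (fun j => X (n + j)) i := by
  induction i with
  | zero => simp [walk]
  | succ i ih => rw [← add_assoc, walk, walk, ih, mul_assoc]

theorem walk_one (X : ℕ → F₂) : walk X 1 = X 0 := by simp [walk]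

/-- The event that the walk is in the target set `W n` at some time `n`. -/
def hitSet (W : ℕ → Set F₂) : Set (ℕ → F₂) := {X | ∃ n, walk X n ∈ W n}

/-- The event that the walk is in the target set `W n` at time `n`, and not before. -/
def firstHit (W : ℕ → Set F₂) (n : ℕ) : Set (ℕ → F₂) :=
  {X | walk X n ∈ W n ∧ ∀ m < n, walk X m ∉ W m}

theorem measurableSet_walk_mem (n : ℕ) (S : Set F₂) :
    MeasurableSet {X : ℕ → F₂ | walk X n ∈ S} :=
  measurable_walk n (MeasurableSet.of_discrete (s := S))

theorem measurableSet_firstHit (W : ℕ → Set F₂) (n : ℕ) : MeasurableSet (firstHit W n) := by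
  refine (measurableSet_walk_mem n _).inter ?_
  have : {X : ℕ → F₂ | ∀ m < n, walk X m ∉ W m} = ⋂ m, ⋂ _ : m < n, {X | walk X m ∈ W m}ᶜ := by
    ext X; simp
  change MeasurableSet {X : ℕ → F₂ | ∀ m < n, walk X m ∉ W m}
  rw [this]
  exact MeasurableSet.iInter fun m => MeasurableSet.iInter fun _ =>
    (measurableSet_walk_mem m _).compl

theorem measurableSet_hitSet (W : ℕ → Set F₂) : MeasurableSet (hitSet W) := by
  have : hitSet W = ⋃ n, {X | walk X n ∈ W n} := by ext X; simp [hitSet]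
  rw [this]
  exact MeasurableSet.iUnion fun n => measurableSet_walk_mem n _

theorem iUnion_firstHit (W : ℕ → Set F₂) : ⋃ n, firstHit W n = hitSet W := by
  classical
  ext X
  simp only [Set.mem_iUnion]
  refine ⟨fun ⟨n, hn⟩ => ⟨n, hn.1⟩, fun h => ?_⟩
  exact ⟨Nat.find h, Nat.find_spec h, fun m hm => Nat.find_min h hm⟩

theorem pairwise_disjoint_firstHit (W : ℕ → Set F₂) :
    Pairwise (Function.onFun Disjoint (firstHit W)) := by
  intro m n hmn
  refine Set.disjoint_left.2 fun X hm hn => ?_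
  rcases lt_or_gt_of_ne hmn with h | h
  · exact hn.2 m h hm.1
  · exact hm.2 n h hn.1

/-- The first event depends only on the first `n` increments and the second only on the later ones,
so under `splice n` their intersection becomes a product set. -/
theorem measure_firstHit_inter (W : ℕ → Set F₂) {D : Set (ℕ → F₂)} (hD : MeasurableSet D)
    (n : ℕ) :
    incrementLaw (firstHit W n ∩ (fun X i => X (n + i)) ⁻¹' D)
      = incrementLaw (firstHit W n) * incrementLaw D := by
  have hθ : Measurable fun (X : ℕ → F₂) (i : ℕ) => X (n + i) :=
    measurable_pi_lambda _ fun i => measurable_pi_apply _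
  conv_lhs => rw [← map_splice n]
  rw [Measure.map_apply (measurable_splice n) ((measurableSet_firstHit W n).inter (hθ hD)),
    ← Measure.prod_prod]
  congr 1
  ext p
  have h1 : ∀ m ≤ n, walk (splice n p) m = walk p.1 m := fun m hm =>
    walk_congr fun i hi => if_pos (by omega)
  have h2 : (fun i => splice n p (n + i)) = p.2 := by
    funext i; simp [splice]
  simp only [Set.mem_preimage, Set.mem_inter_iff, Set.mem_prod, h2, firstHit, Set.mem_ofPred_eq,
    h1 n le_rfl]
  refine and_congr_left fun _ => and_congr_right fun _ => forall₂_congr fun m hm => ?_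
  rw [h1 m hm.le]

theorem strong_markov (W : ℕ → Set F₂) {D : Set (ℕ → F₂)} (hD : MeasurableSet D) :
    incrementLaw (⋃ n, firstHit W n ∩ (fun X i => X (n + i)) ⁻¹' D)
      = incrementLaw (hitSet W) * incrementLaw D := by
  have hθ : ∀ n : ℕ, Measurable fun (X : ℕ → F₂) (i : ℕ) => X (n + i) := fun n =>
    measurable_pi_lambda _ fun i => measurable_pi_apply _
  rw [measure_iUnion, ← iUnion_firstHit, measure_iUnion (pairwise_disjoint_firstHit W)
    (measurableSet_firstHit W), ← ENNReal.tsum_mul_right]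
  · exact tsum_congr fun n => measure_firstHit_inter W hD n
  · exact fun m n hmn => (pairwise_disjoint_firstHit W hmn).mono
      Set.inter_subset_left Set.inter_subset_left
  · exact fun n => (measurableSet_firstHit W n).inter (hθ n hD)

/-! ### Trajectories from arbitrary vertices and shift-invariant events. -/

theorem CosetPath.mk_eq_mk {K : Subgroup F₂} {g h : ℕ → F₂} (H : ∀ n, g n * (h n)⁻¹ ∈ K) :
    CosetPath.mk K g = CosetPath.mk K h := by
  apply Subtype.ext
  apply Prod.ext
  · rfl
  · funext n
    exact (rightCoset_eq_iff K).2 (by simpa using K.inv_mem (H n))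

/-- The trajectory of the walk on `K \ G` started at `K g`. -/
def cosetWalkFrom (g : F₂) (p : Subgroup F₂ × (ℕ → F₂)) : CosetPath :=
  CosetPath.mk p.1 fun n => g * walk p.2 n

theorem cosetWalkFrom_one : cosetWalkFrom 1 = cosetWalk := by
  funext p; simp [cosetWalkFrom, cosetWalk]

/-- From `g K h = (g K g⁻¹) g h`: translating a trajectory conjugates the subgroup and moves the
starting vertex from the root to the coset of `g`. -/
theorem smul_cosetWalk (g : F₂) (p : Subgroup F₂ × (ℕ → F₂)) :
    g • cosetWalk p = cosetWalkFrom g (MulAut.conj g • p.1, p.2) := by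
  apply Subtype.ext
  apply Prod.ext
  · rfl
  · funext n
    ext h
    rw [CosetPath.smul_snd]
    simp only [cosetWalk, cosetWalkFrom, CosetPath.mk,
      Set.mem_smul_set_iff_inv_smul_mem, ← MulOpposite.op_inv,
      MulOpposite.smul_eq_mul_unop, MulOpposite.unop_op, SetLike.mem_coe, smul_eq_mul,
      Subgroup.mem_pointwise_smul_iff_inv_smul_mem, MulAut.smul_def, ← map_inv,
      MulAut.conj_apply]
    simp [mul_assoc]

theorem measurable_cosetWalkFrom (g : F₂) : Measurable (cosetWalkFrom g) := by
  have h : cosetWalkFrom g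
      = (fun x => g • x) ∘ cosetWalk ∘ Prod.map (fun K => MulAut.conj g⁻¹ • K) id := by
    funext p
    simp [smul_cosetWalk, smul_smul]
  rw [h]
  exact (measurable_smul_cosetPath g).comp
    (measurable_cosetWalk.comp ((measurable_conj g⁻¹).prodMap measurable_id))

theorem iterate_shift_mk (K : Subgroup F₂) (g : ℕ → F₂) (n : ℕ) :
    CosetPath.shift^[n] (CosetPath.mk K g) = CosetPath.mk K fun i => g (n + i) := by
  induction n generalizing g with
  | zero => simp
  | succ n ih =>
    rw [Function.iterate_succ_apply]
    have : CosetPath.shift (CosetPath.mk K g) = CosetPath.mk K fun i => g (i + 1) := rfl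
    rw [this, ih]
    congr 1
    funext i
    congr 1
    omega

theorem mem_iff_iterate_shift_mem {D : Set CosetPath} (hD : CosetPath.shift ⁻¹' D = D)
    (x : CosetPath) (n : ℕ) : CosetPath.shift^[n] x ∈ D ↔ x ∈ D := by
  induction n with
  | zero => rfl
  | succ n ih =>
    rw [Function.iterate_succ_apply', ← ih]
    conv_rhs => rw [← hD]
    rfl

theorem measurable_prodMk_incr (K : Subgroup F₂) :
    Measurable fun X : ℕ → F₂ => (K, X) := measurable_prodMk_left

/-- The probability that the walk on `K \ G` started at `K u` ever visits `K v`. -/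
noncomputable def hitProb (u v : F₂) (K : Subgroup F₂) : ℝ≥0∞ :=
  incrementLaw {X | ∃ n, u * walk X n * v⁻¹ ∈ K}

/-- If the trajectories from `K u` in a shift-invariant event visit `K v`, then the probability
of the event factors as the hitting probability times the probability from `K v`. -/
theorem measure_cosetWalkFrom_eq_mul {D : Set CosetPath} (hDm : MeasurableSet D)
    (hD : CosetPath.shift ⁻¹' D = D) (K : Subgroup F₂) (u v : F₂)
    (hhit : ∀ᵐ X ∂incrementLaw, cosetWalkFrom u (K, X) ∈ D → ∃ n, u * walk X n * v⁻¹ ∈ K) :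
    incrementLaw {X | cosetWalkFrom u (K, X) ∈ D}
      = hitProb u v K * incrementLaw {X | cosetWalkFrom v (K, X) ∈ D} := by
  have hD' : MeasurableSet {X | cosetWalkFrom v (K, X) ∈ D} :=
    ((measurable_cosetWalkFrom v).comp (measurable_prodMk_incr K)) hDm
  let W : ℕ → Set F₂ := fun _ => {g | u * g * v⁻¹ ∈ K}
  have key := strong_markov W hD'
  have hW : incrementLaw (hitSet W) = hitProb u v K := rfl
  rw [← hW, ← key]
  have hshift : ∀ n X, X ∈ firstHit W n →
      (cosetWalkFrom u (K, X) ∈ D ↔ cosetWalkFrom v (K, fun i => X (n + i)) ∈ D) := by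
    intro n X hX
    rw [← mem_iff_iterate_shift_mem hD _ n]
    -- At the hitting time the walk is at the vertex `K v`, so the remaining trajectory is one from
    -- `K v`, although the representatives `u * walk X n` and `v` may differ by an element of `K`.
    have : CosetPath.shift^[n] (cosetWalkFrom u (K, X))
        = cosetWalkFrom v (K, fun i => X (n + i)) := by
      rw [cosetWalkFrom, iterate_shift_mk]
      refine CosetPath.mk_eq_mk fun i => ?_
      have h := hX.1
      simp only [W, Set.mem_ofPred_eq] at h
      rw [walk_add]
      convert h using 1
      group
    rw [this]
  refine measure_congr ?_
  filter_upwards [hhit] with X hX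
  refine propext ⟨fun h => ?_, fun h => ?_⟩
  · have : X ∈ hitSet W := hX h
    rw [← iUnion_firstHit] at this
    obtain ⟨n, hn⟩ := Set.mem_iUnion.1 this
    exact Set.mem_iUnion.2 ⟨n, hn, (hshift n X hn).1 h⟩
  · obtain ⟨n, hn, h'⟩ := Set.mem_iUnion.1 h
    exact (hshift n X hn).2 h'

/-! ### The two sides of an edge at the root -/

/-- `{K g, K h}` is the edge `{K, K s}`. -/
def Crosses (K : Subgroup F₂) (s g h : F₂) : Prop :=
  (g ∈ K ∧ h * s⁻¹ ∈ K) ∨ (g * s⁻¹ ∈ K ∧ h ∈ K)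

theorem Crosses.symm {K : Subgroup F₂} {s g h : F₂} (H : Crosses K s g h) : Crosses K s h g :=
  (Or.symm H).imp And.symm And.symm

theorem Crosses.hits_left {K : Subgroup F₂} {s g h : F₂} (H : Crosses K s g h) : g ∈ K ∨ h ∈ K :=
  H.imp And.left And.right

theorem Crosses.hits_right {K : Subgroup F₂} {s g h : F₂} (H : Crosses K s g h) :
    g * s⁻¹ ∈ K ∨ h * s⁻¹ ∈ K :=
  H.elim (fun h => Or.inr h.2) fun h => Or.inl h.1

/-- The elements `g` such that `K g` can be reached from `K s` in `n` steps none of which uses the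
edge `{K, K s}`. -/
def branchLevel (K : Subgroup F₂) (s : F₂) : ℕ → Set F₂
  | 0 => {g | g * s⁻¹ ∈ K}
  | n + 1 => {g | g ∈ branchLevel K s n ∨
      ∃ t ∈ gens, g * t ∈ branchLevel K s n ∧ ¬ Crosses K s g (g * t)}

/-- The elements `g` such that `K g` is on the side of `K s` of the edge `{K, K s}`. -/
def branch (K : Subgroup F₂) (s : F₂) : Set F₂ := {g | ∃ n, g ∈ branchLevel K s n}

theorem branchLevel_mono (K : Subgroup F₂) (s : F₂) : Monotone (branchLevel K s) :=
  monotone_nat_of_le_succ fun _ _ hg => Or.inl hg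

theorem mem_branch_of_mul_inv_mem {K : Subgroup F₂} {s g : F₂} (h : g * s⁻¹ ∈ K) :
    g ∈ branch K s := ⟨0, h⟩

theorem mul_mem_branch {K : Subgroup F₂} {s g t : F₂} (hg : g ∈ branch K s) (ht : t ∈ gens)
    (h : ¬ Crosses K s g (g * t)) : g * t ∈ branch K s := by
  obtain ⟨n, hn⟩ := hg
  refine ⟨n + 1, Or.inr ⟨t⁻¹, inv_mem_gens ht, ?_, ?_⟩⟩
  · simpa using hn
  · simpa using fun H : Crosses K s (g * t) g => h H.symm

theorem mul_mem_branch_iff {K : Subgroup F₂} {s g t : F₂} (ht : t ∈ gens)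
    (h : ¬ Crosses K s g (g * t)) : g * t ∈ branch K s ↔ g ∈ branch K s := by
  refine ⟨fun H => ?_, fun H => mul_mem_branch H ht h⟩
  have := mul_mem_branch H (inv_mem_gens ht) (by simpa using fun H => h (Crosses.symm H))
  simpa using this

theorem crosses_mul_left {K : Subgroup F₂} {k : F₂} (hk : k ∈ K) (s g h : F₂) :
    Crosses K s (k * g) (k * h) ↔ Crosses K s g h := by
  simp only [Crosses, mul_assoc, K.mul_mem_cancel_left hk]

theorem mul_mem_branchLevel {K : Subgroup F₂} {k : F₂} (hk : k ∈ K) (s g : F₂) (n : ℕ) :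
    k * g ∈ branchLevel K s n ↔ g ∈ branchLevel K s n := by
  induction n generalizing g with
  | zero => simp only [branchLevel, Set.mem_ofPred_eq, mul_assoc, K.mul_mem_cancel_left hk]
  | succ n ih =>
    simp only [branchLevel, Set.mem_ofPred_eq, mul_assoc, ih, crosses_mul_left hk]

/-- The branch is a union of right cosets of `K`, that is, a set of vertices of the Schreier graph.
-/
theorem mul_mem_branch_iff_right {K : Subgroup F₂} {k : F₂} (hk : k ∈ K) (s g : F₂) :
    k * g ∈ branch K s ↔ g ∈ branch K s :=
  exists_congr fun n => mul_mem_branchLevel hk s g n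

/-! ### Branches in the Schreier graph and bridges. -/

theorem rightCoset_eq_rightCoset {K : Subgroup F₂} {g h : F₂} :
    rightCoset K g = rightCoset K h ↔ h * g⁻¹ ∈ K := by
  rw [rightCoset, rightCoset, Quotient.eq]
  exact QuotientGroup.rightRel_apply

theorem rightCoset_one_eq {K : Subgroup F₂} {g : F₂} :
    rightCoset K g = rightCoset K 1 ↔ g ∈ K := by
  rw [rightCoset_eq_rightCoset, one_mul, K.inv_mem_iff]

theorem rightCoset_eq {K : Subgroup F₂} {g s : F₂} :
    rightCoset K g = rightCoset K s ↔ g * s⁻¹ ∈ K := by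
  rw [eq_comm, rightCoset_eq_rightCoset]

theorem schreierGraph_adj {K : Subgroup F₂} {g t : F₂} (ht : t ∈ gens)
    (hne : rightCoset K g ≠ rightCoset K (g * t)) :
    (schreierGraph K).Adj (rightCoset K g) (rightCoset K (g * t)) := by
  rw [schreierGraph, SimpleGraph.fromRel_adj]
  refine ⟨hne, ?_⟩
  simp only [gens, Finset.mem_insert, Finset.mem_singleton] at ht
  rcases ht with rfl | rfl | rfl | rfl
  · exact Or.inl ⟨g, rfl, Or.inl rfl⟩
  · exact Or.inl ⟨g, rfl, Or.inr rfl⟩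
  · exact Or.inr ⟨g * a⁻¹, rfl, Or.inl (by simp)⟩
  · exact Or.inr ⟨g * b⁻¹, rfl, Or.inr (by simp)⟩

theorem reachable_of_mem_branchLevel {K : Subgroup F₂} {s : F₂} (n : ℕ) {g : F₂}
    (hg : g ∈ branchLevel K s n) :
    ((schreierGraph K).deleteEdges {s(rightCoset K 1, rightCoset K s)}).Reachable
      (rightCoset K s) (rightCoset K g) := by
  induction n generalizing g with
  | zero =>
    rw [rightCoset_eq.2 hg]
  | succ n ih =>
    rcases hg with hg | ⟨t, ht, hg, hc⟩
    · exact ih hg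
    · refine (ih hg).trans ?_
      by_cases hne : rightCoset K g = rightCoset K (g * t)
      · rw [← hne]
      · refine (SimpleGraph.Adj.reachable ?_).symm
        rw [SimpleGraph.deleteEdges_adj]
        refine ⟨schreierGraph_adj ht hne, fun h => hc ?_⟩
        rw [Set.mem_singleton_iff, Sym2.eq_iff] at h
        simp only [rightCoset_eq] at h
        simpa only [Crosses, inv_one, mul_one] using h

/-- In an acyclic graph every edge is a bridge, so the root cannot be reached from `K s` once the
edge joining them is deleted. All uses of tree-likeness go through this lemma. -/
theorem TreeLike.notMem_branch {K : Subgroup F₂} (hK : TreeLike K) {s : F₂} (hs : s ∈ gens)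
    (hsK : s ∉ K) {g : F₂} (hg : g ∈ K) : g ∉ branch K s := by
  rintro ⟨n, hn⟩
  have hr := reachable_of_mem_branchLevel n hn
  rw [rightCoset_one_eq.2 hg] at hr
  have hadj : (schreierGraph K).Adj (rightCoset K 1) (rightCoset K (1 * s)) :=
    schreierGraph_adj hs fun h => hsK (by simpa using rightCoset_eq_rightCoset.1 h)
  rw [one_mul] at hadj
  have := SimpleGraph.isAcyclic_iff_forall_adj_isBridge.1 hK.isAcyclic hadj
  exact SimpleGraph.isBridge_iff.1 this hr.symm

/-! ### Walks and branches -/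

theorem walk_mem_branch_iff {K : Subgroup F₂} {s u : F₂} {X : ℕ → F₂} (hX : ∀ n, X n ∈ gens)
    {N : ℕ} (h : ∀ n, N ≤ n → ¬ Crosses K s (u * walk X n) (u * walk X (n + 1))) (n : ℕ)
    (hn : N ≤ n) : u * walk X n ∈ branch K s ↔ u * walk X N ∈ branch K s := by
  induction n, hn using Nat.le_induction with
  | base => rfl
  | succ n hn ih =>
    rw [← ih]
    have := h n hn
    rw [walk, ← mul_assoc] at this ⊢
    exact mul_mem_branch_iff (hX n) this

/-- The walk starts off the branch and can enter it only across the edge, landing at `K s`, which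
has level 0. Each further step inside raises the level by at most one. At time `n` the infinite
condition of lying in `branch` may therefore be replaced by the clopen condition of lying in
`branchLevel` at `n`. -/
theorem walk_mem_branchLevel {K : Subgroup F₂} (hK : TreeLike K) {s : F₂} (hs : s ∈ gens)
    (hsK : s ∉ K) {X : ℕ → F₂} (hX : ∀ n, X n ∈ gens) (n : ℕ) (h : walk X n ∈ branch K s) :
    walk X n ∈ branchLevel K s n := by
  induction n with
  | zero => exact absurd h (hK.notMem_branch hs hsK K.one_mem)
  | succ n ih =>
    rw [walk] at h ⊢
    by_cases hc : Crosses K s (walk X n) (walk X n * X n)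
    · rcases hc with hc | hc
      · exact branchLevel_mono K s (Nat.zero_le _) hc.2
      · exact absurd h (hK.notMem_branch hs hsK hc.2)
    · have h' := ih ((mul_mem_branch_iff (hX n) hc).1 h)
      refine Or.inr ⟨(X n)⁻¹, inv_mem_gens (hX n), by simpa using h', ?_⟩
      simpa using fun H => hc (Crosses.symm H)

/-- The event that the trajectory `(K; K g₀, K g₁, …)` is eventually on the side of `K s` of the
edge `{K, K s}`. -/
def branchEvent (s : F₂) : Set CosetPath :=
  {x | ∃ N, ∀ n, N ≤ n → ∃ g, g ∈ x.1.2 n ∧ g ∈ branch x.1.1 s}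

theorem shift_preimage_branchEvent (s : F₂) :
    CosetPath.shift ⁻¹' branchEvent s = branchEvent s := by
  ext x
  constructor
  · rintro ⟨N, h⟩
    refine ⟨N + 1, fun n hn => ?_⟩
    obtain ⟨m, rfl⟩ : ∃ m, n = m + 1 := ⟨n - 1, by omega⟩
    exact h m (by omega)
  · rintro ⟨N, h⟩
    exact ⟨N, fun n hn => h (n + 1) (by omega)⟩

/-! ### Dependence of branches on the subgroup. -/

theorem isClopen_mem (g : F₂) : IsClopen {K : Subgroup F₂ | g ∈ K} := by
  have hc : Continuous fun K : Subgroup F₂ => subgroupIndicator K g :=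
    (continuous_apply (A := fun _ : F₂ => Bool) g).comp
      (continuous_induced_dom (f := subgroupIndicator))
  have : {K : Subgroup F₂ | g ∈ K} = (fun K => subgroupIndicator K g) ⁻¹' {true} := by
    ext K; simp [subgroupIndicator]
  rw [this]
  exact (isClopen_discrete _).preimage hc

theorem isClopen_crosses (s g h : F₂) : IsClopen {K : Subgroup F₂ | Crosses K s g h} :=
  ((isClopen_mem g).inter (isClopen_mem (h * s⁻¹))).union
    ((isClopen_mem (g * s⁻¹)).inter (isClopen_mem h))

theorem isClopen_mem_branchLevel (s g : F₂) (n : ℕ) :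
    IsClopen {K : Subgroup F₂ | g ∈ branchLevel K s n} := by
  induction n generalizing g with
  | zero => exact isClopen_mem _
  | succ n ih =>
    have : {K : Subgroup F₂ | g ∈ branchLevel K s (n + 1)} = {K | g ∈ branchLevel K s n} ∪
        ⋃ t ∈ gens, {K | g * t ∈ branchLevel K s n} ∩ {K | Crosses K s g (g * t)}ᶜ := by
      ext K
      simp [branchLevel, and_left_comm]
    rw [this]
    exact (ih g).union (isClopen_biUnion_finset fun t _ =>
      (ih _).inter (isClopen_crosses _ _ _).compl)

theorem measurableSet_mem_branch (s g : F₂) :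
    MeasurableSet {K : Subgroup F₂ | g ∈ branch K s} := by
  have : {K : Subgroup F₂ | g ∈ branch K s} = ⋃ n, {K | g ∈ branchLevel K s n} := by
    ext K; simp [branch]
  rw [this]
  exact MeasurableSet.iUnion fun n => (isClopen_mem_branchLevel s g n).isOpen.measurableSet

theorem measurable_base : Measurable fun x : CosetPath => x.1.1 :=
  measurable_fst.comp measurable_subtype_coe

theorem measurableSet_branchEvent (s : F₂) : MeasurableSet (branchEvent s) := by
  have : branchEvent s = ⋃ N : ℕ, ⋂ n : ℕ, ⋂ _ : N ≤ n, ⋃ g : F₂,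
      {x : CosetPath | g ∈ x.1.2 n} ∩ {x | g ∈ branch x.1.1 s} := by
    ext x; simp [branchEvent]
  rw [this]
  refine MeasurableSet.iUnion fun N => MeasurableSet.iInter fun n => MeasurableSet.iInter fun _ =>
    MeasurableSet.iUnion fun g => MeasurableSet.inter ?_ ?_
  · have h : Measurable fun x : CosetPath => x.1.2 n :=
      (measurable_pi_apply n).comp (measurable_snd.comp measurable_subtype_coe)
    exact measurableSet_setOfPred.2 (measurable_set_iff.1 h g)
  · exact measurable_base (measurableSet_mem_branch s g)

theorem cosetWalkFrom_mem_branchEvent {u s : F₂} {K : Subgroup F₂} {X : ℕ → F₂} :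
    cosetWalkFrom u (K, X) ∈ branchEvent s ↔
      ∃ N, ∀ n, N ≤ n → u * walk X n ∈ branch K s := by
  refine exists_congr fun N => forall₂_congr fun n _ => ?_
  constructor
  · rintro ⟨g, hg, hb⟩
    have hg' : g * (u * walk X n)⁻¹ ∈ K := by
      have : g ∈ MulOpposite.op (u * walk X n) • (K : Set F₂) := hg
      simpa [Set.mem_smul_set_iff_inv_smul_mem, ← MulOpposite.op_inv] using this
    have := (mul_mem_branch_iff_right hg' s (u * walk X n)).1
    rw [inv_mul_cancel_right] at this
    exact this hb
  · intro h
    refine ⟨u * walk X n, ?_, h⟩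
    change _ ∈ MulOpposite.op (u * walk X n) • (K : Set F₂)
    simp [Set.mem_smul_set_iff_inv_smul_mem, ← MulOpposite.op_inv]

/-! ### Comparison of the walks started at the two ends of an edge -/

/-- A walk that never visits `K s` never crosses the edge, so it stays on the side where it started.
Starting at `K`, that side is not the branch. -/
theorem measure_cosetWalk_inter_branchEvent {K : Subgroup F₂} (hK : TreeLike K) {s : F₂}
    (hs : s ∈ gens) (hsK : s ∉ K) {A : Set CosetPath} (hAm : MeasurableSet A)
    (hA : CosetPath.shift ⁻¹' A = A) :
    incrementLaw {X | cosetWalkFrom 1 (K, X) ∈ A ∩ branchEvent s}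
      = hitProb 1 s K * incrementLaw {X | cosetWalkFrom s (K, X) ∈ A ∩ branchEvent s} := by
  refine measure_cosetWalkFrom_eq_mul (hAm.inter (measurableSet_branchEvent s))
    (by rw [Set.preimage_inter, hA, shift_preimage_branchEvent]) K 1 s ?_
  filter_upwards [ae_forall_mem_gens] with X hX hD
  by_contra! hno
  obtain ⟨N, hN⟩ := cosetWalkFrom_mem_branchEvent.1 hD.2
  have h0 := (walk_mem_branch_iff hX (N := 0) (fun n _ hc =>
    hc.hits_right.elim (hno n) (hno (n + 1))) N (Nat.zero_le _)).1 (hN N le_rfl)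
  exact hK.notMem_branch hs hsK (by simp [walk]) h0

/-- A walk from `K s` that avoids `K` never leaves the branch. The complement of `branchEvent s`
also contains the trajectories that change sides forever; these visit `K` as well, so recurrent
graphs need no separate treatment. -/
theorem measure_cosetWalk_diff_branchEvent {K : Subgroup F₂} {s : F₂}
    {A : Set CosetPath} (hAm : MeasurableSet A)
    (hA : CosetPath.shift ⁻¹' A = A) :
    incrementLaw {X | cosetWalkFrom s (K, X) ∈ A \ branchEvent s}
      = hitProb s 1 K * incrementLaw {X | cosetWalkFrom 1 (K, X) ∈ A \ branchEvent s} := by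
  refine measure_cosetWalkFrom_eq_mul (hAm.diff (measurableSet_branchEvent s))
    (by rw [Set.preimage_sdiff, hA, shift_preimage_branchEvent]) K s 1 ?_
  filter_upwards [ae_forall_mem_gens] with X hX hD
  by_contra! hno
  refine hD.2 (cosetWalkFrom_mem_branchEvent.2 ⟨0, fun n _ => ?_⟩)
  rw [inv_one] at hno
  refine (walk_mem_branch_iff hX (N := 0) (fun n _ hc =>
    hc.hits_left.elim (fun h => hno n (by simpa using h)) fun h => hno (n + 1) (by simpa using h))
    n (Nat.zero_le _)).2 ?_
  exact mem_branch_of_mul_inv_mem (by simp [walk])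

/-! ### The density of the boundary measure translated by a generator -/

theorem hitProb_le_one (u v : F₂) (K : Subgroup F₂) : hitProb u v K ≤ 1 := prob_le_one

theorem quarter_le_measure_head {s : F₂} (hs : s ∈ gens) :
    4⁻¹ ≤ incrementLaw {X : ℕ → F₂ | X 0 = s} :=
  (quarter_le_stepMeasure hs).trans_eq
    ((measurePreserving_eval 0).measure_preimage
      (MeasurableSet.singleton s).nullMeasurableSet).symm

theorem quarter_le_hitProb {u v : F₂} (h : u⁻¹ * v ∈ gens) (K : Subgroup F₂) :
    4⁻¹ ≤ hitProb u v K := by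
  refine (quarter_le_measure_head h).trans (measure_mono fun X hX => ⟨1, ?_⟩)
  rw [walk_one, show X 0 = u⁻¹ * v from hX]
  simp

theorem quarter_le_hitProb_one_left {s : F₂} (hs : s ∈ gens) (K : Subgroup F₂) :
    4⁻¹ ≤ hitProb 1 s K := quarter_le_hitProb (by simpa using hs) K

theorem quarter_le_hitProb_one_right {s : F₂} (hs : s ∈ gens) (K : Subgroup F₂) :
    4⁻¹ ≤ hitProb s 1 K := quarter_le_hitProb (by simpa using inv_mem_gens hs) K

theorem hitProb_eq_one {u v : F₂} {K : Subgroup F₂} (h : u * v⁻¹ ∈ K) : hitProb u v K = 1 := by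
  have : {X : ℕ → F₂ | ∃ n, u * walk X n * v⁻¹ ∈ K} = Set.univ :=
    Set.eq_univ_of_forall fun X => ⟨0, by simpa [walk] using h⟩
  rw [hitProb, this, measure_univ]

theorem measurableSet_mul_walk_mem (u v : F₂) (n : ℕ) :
    MeasurableSet {p : Subgroup F₂ × (ℕ → F₂) | u * walk p.2 n * v⁻¹ ∈ p.1} := by
  have : {p : Subgroup F₂ × (ℕ → F₂) | u * walk p.2 n * v⁻¹ ∈ p.1}
      = ⋃ z : F₂, (Prod.snd ⁻¹' {X | walk X n = z}) ∩ (Prod.fst ⁻¹' {K | u * z * v⁻¹ ∈ K}) := by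
    ext p; simp
  rw [this]
  exact MeasurableSet.iUnion fun z =>
    (measurable_snd (measurable_walk n (measurableSet_singleton z))).inter
      (measurable_fst (measurableSet_mem_subgroup _))

theorem measurable_hitProb (u v : F₂) : Measurable (hitProb u v) := by
  have h : MeasurableSet {p : Subgroup F₂ × (ℕ → F₂) | ∃ n, u * walk p.2 n * v⁻¹ ∈ p.1} := by
    have : {p : Subgroup F₂ × (ℕ → F₂) | ∃ n, u * walk p.2 n * v⁻¹ ∈ p.1}
        = ⋃ n, {p | u * walk p.2 n * v⁻¹ ∈ p.1} := by ext p; simp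
    rw [this]
    exact MeasurableSet.iUnion fun n => measurableSet_mul_walk_mem u v n
  exact measurable_measure_prodMk_left h

open Classical in
/-- The density, on shift-invariant events, of the walk started at `K s` with respect to the walk
started at `K`. -/
noncomputable def edgeDensity (s : F₂) (x : CosetPath) : ℝ≥0∞ :=
  if x ∈ branchEvent s then (hitProb 1 s x.1.1)⁻¹ else hitProb s 1 x.1.1

theorem measurable_edgeDensity_invariants (s : F₂) :
    Measurable[MeasurableSpace.invariants CosetPath.shift] (edgeDensity s) := by
  have hbase : Measurable[MeasurableSpace.invariants CosetPath.shift]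
      fun x : CosetPath => x.1.1 := fun S hS => ⟨measurable_base hS, rfl⟩
  have h1 : Measurable[MeasurableSpace.invariants CosetPath.shift]
      fun x : CosetPath => (hitProb 1 s x.1.1)⁻¹ := (measurable_hitProb 1 s).inv.comp hbase
  have h2 : Measurable[MeasurableSpace.invariants CosetPath.shift]
      fun x : CosetPath => hitProb s 1 x.1.1 := (measurable_hitProb s 1).comp hbase
  have hE : MeasurableSet[MeasurableSpace.invariants CosetPath.shift] (branchEvent s) :=
    ⟨measurableSet_branchEvent s, shift_preimage_branchEvent s⟩
  exact Measurable.ite hE h1 h2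

theorem measurable_edgeDensity (s : F₂) : Measurable (edgeDensity s) :=
  (measurable_edgeDensity_invariants s).mono (MeasurableSpace.invariants_le _) le_rfl

theorem quarter_le_edgeDensity {s : F₂} (hs : s ∈ gens) (x : CosetPath) :
    4⁻¹ ≤ edgeDensity s x := by
  unfold edgeDensity
  split_ifs
  · rw [ENNReal.inv_le_inv]
    exact (hitProb_le_one _ _ _).trans (by norm_num)
  · exact quarter_le_hitProb_one_right hs _

theorem edgeDensity_le_four {s : F₂} (hs : s ∈ gens) (x : CosetPath) : edgeDensity s x ≤ 4 := by
  unfold edgeDensity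
  split_ifs
  · rw [← inv_inv (4 : ℝ≥0∞), ENNReal.inv_le_inv]
    exact quarter_le_hitProb_one_left hs _
  · exact (hitProb_le_one _ _ _).trans (by norm_num)

theorem lintegral_edgeDensity_fiber {K : Subgroup F₂} (hK : TreeLike K) {s : F₂}
    (hs : s ∈ gens) {A : Set CosetPath} (hAm : MeasurableSet A)
    (hA : CosetPath.shift ⁻¹' A = A) :
    ∫⁻ X in {X | cosetWalk (K, X) ∈ A}, edgeDensity s (cosetWalk (K, X)) ∂incrementLaw
      = incrementLaw {X | cosetWalkFrom s (K, X) ∈ A} := by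
  have hm : Measurable fun X => cosetWalk (K, X) :=
    measurable_cosetWalk.comp (measurable_prodMk_incr K)
  have hm' : Measurable fun X => cosetWalkFrom s (K, X) :=
    (measurable_cosetWalkFrom s).comp (measurable_prodMk_incr K)
  by_cases hsK : s ∈ K
  -- Here the edge is a loop: both starting vertices coincide and both hitting probabilities are 1.
  · have h1 : ∀ x : CosetPath, x.1.1 = K → edgeDensity s x = 1 := by
      rintro x rfl
      unfold edgeDensity
      rw [hitProb_eq_one (by simpa using hsK), hitProb_eq_one (by simpa using hsK)]
      simp
    have h2 : ∀ X, cosetWalkFrom s (K, X) = cosetWalk (K, X) := fun X =>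
      CosetPath.mk_eq_mk fun n => by simpa using hsK
    simp_rw [h2, h1 (cosetWalk (K, _)) rfl]
    simp
  · have hE : MeasurableSet {X | cosetWalk (K, X) ∈ branchEvent s} :=
      hm (measurableSet_branchEvent s)
    have hAK : MeasurableSet {X | cosetWalk (K, X) ∈ A} := hm hAm
    rw [← lintegral_inter_add_sdiff _ _ hE]
    have i1 : ∫⁻ X in {X | cosetWalk (K, X) ∈ A} ∩ {X | cosetWalk (K, X) ∈ branchEvent s},
        edgeDensity s (cosetWalk (K, X)) ∂incrementLaw
        = incrementLaw {X | cosetWalkFrom s (K, X) ∈ A ∩ branchEvent s} := by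
      rw [setLIntegral_congr_fun (f := fun X => edgeDensity s (cosetWalk (K, X)))
        (g := fun _ => (hitProb 1 s K)⁻¹) (hAK.inter hE)
        (fun X hX => if_pos hX.2), setLIntegral_const]
      have := measure_cosetWalk_inter_branchEvent hK hs hsK hAm hA
      rw [cosetWalkFrom_one] at this
      change _ * incrementLaw {X | cosetWalk (K, X) ∈ A ∩ branchEvent s} = _
      rw [this, ← mul_assoc, ENNReal.inv_mul_cancel, one_mul]
      · exact ((by norm_num : (0 : ℝ≥0∞) < 4⁻¹).trans_le (quarter_le_hitProb_one_left hs K)).ne'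
      · exact ((hitProb_le_one 1 s K).trans_lt ENNReal.one_lt_top).ne
    have i2 : ∫⁻ X in {X | cosetWalk (K, X) ∈ A} \ {X | cosetWalk (K, X) ∈ branchEvent s},
        edgeDensity s (cosetWalk (K, X)) ∂incrementLaw
        = incrementLaw {X | cosetWalkFrom s (K, X) ∈ A \ branchEvent s} := by
      rw [setLIntegral_congr_fun (f := fun X => edgeDensity s (cosetWalk (K, X)))
        (g := fun _ => hitProb s 1 K) (hAK.diff hE)
        (fun X hX => if_neg hX.2), setLIntegral_const]
      have := measure_cosetWalk_diff_branchEvent (K := K) (s := s) hAm hA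
      rw [cosetWalkFrom_one] at this
      exact this.symm
    rw [i1, i2]
    exact measure_inter_add_sdiff _ (hm' (measurableSet_branchEvent s))

/-- Conjugation invariance enters here: after translation the subgroup is `s K s⁻¹`, which again has
law `η`. -/
theorem map_smul_pathLaw {η : ProbabilityMeasure (Subgroup F₂)} (hη : IsConjInvariant η)
    (s : F₂) : (pathLaw η).map (fun x => s • x)
      = ((η : Measure (Subgroup F₂)).prod incrementLaw).map (cosetWalkFrom s) := by
  rw [pathLaw, Measure.map_map (measurable_smul_cosetPath s) measurable_cosetWalk]
  have h : (fun x => s • x) ∘ cosetWalk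
      = cosetWalkFrom s ∘ Prod.map (fun K => MulAut.conj s • K) id := by
    funext p; exact smul_cosetWalk s p
  rw [h, ← Measure.map_map (measurable_cosetWalkFrom s)
    ((measurable_conj s).prodMap measurable_id),
    ← Measure.map_prod_map _ _ (measurable_conj s) measurable_id, hη s, Measure.map_id]

theorem map_smul_pathLaw_apply {η : ProbabilityMeasure (Subgroup F₂)} (hη : IsConjInvariant η)
    (htree : ∀ᵐ K ∂(η : Measure (Subgroup F₂)), TreeLike K) {s : F₂} (hs : s ∈ gens)
    {A : Set CosetPath} (hA : MeasurableSet[MeasurableSpace.invariants CosetPath.shift] A) :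
    (pathLaw η).map (fun x => s • x) A = ∫⁻ x in A, edgeDensity s x ∂(pathLaw η) := by
  have hind : Measurable (A.indicator (edgeDensity s)) :=
    (measurable_edgeDensity s).indicator hA.1
  rw [map_smul_pathLaw hη, Measure.map_apply (measurable_cosetWalkFrom s) hA.1,
    Measure.prod_apply (measurable_cosetWalkFrom s hA.1), ← lintegral_indicator hA.1, pathLaw,
    lintegral_map hind measurable_cosetWalk,
    lintegral_prod (fun p => A.indicator (edgeDensity s) (cosetWalk p))
      (hind.comp measurable_cosetWalk).aemeasurable]
  refine lintegral_congr_ae ?_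
  filter_upwards [htree] with K hK
  have hAK : MeasurableSet {X | cosetWalk (K, X) ∈ A} :=
    (measurable_cosetWalk.comp (measurable_prodMk_incr K)) hA.1
  rw [show Prod.mk K ⁻¹' (cosetWalkFrom s ⁻¹' A) = {X | cosetWalkFrom s (K, X) ∈ A} from rfl,
    ← lintegral_edgeDensity_fiber hK hs hA.1 hA.2, ← lintegral_indicator hAK]
  rfl

/-! ### Transfer to an arbitrary realization of the Poisson boundary. -/

namespace PoissonBoundary

universe u

variable {η : ProbabilityMeasure (Subgroup F₂)} (B : PoissonBoundary.{u} η)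

instance : IsProbabilityMeasure B.measure :=
  Measure.isProbabilityMeasure_map B.measurable_bnd.aemeasurable

/-- Shift-invariant functions factor through the boundary map, modulo negligible sets. -/
theorem exists_factor {f : CosetPath → ℝ≥0∞}
    (hf : Measurable[MeasurableSpace.invariants CosetPath.shift] f) :
    ∃ φ : B.carrier → ℝ≥0∞, Measurable φ ∧
      ∀ δ : F₂, ∀ᵐ x ∂(pathLaw η), φ (B.bnd (δ • x)) = f (δ • x) := by
  refine @Measurable.ennreal_induction CosetPath (MeasurableSpace.invariants CosetPath.shift)
    (fun f => ∃ φ : B.carrier → ℝ≥0∞, Measurable φ ∧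
      ∀ δ : F₂, ∀ᵐ x ∂(pathLaw η), φ (B.bnd (δ • x)) = f (δ • x)) ?_ ?_ ?_ f hf
  · intro c A hA
    obtain ⟨E, hE, h⟩ := B.exists_preimage A hA
    refine ⟨E.indicator fun _ => c, measurable_const.indicator hE, fun δ => ?_⟩
    filter_upwards [h δ] with x hx
    by_cases hxA : δ • x ∈ A
    · rw [Set.indicator_of_mem hxA, Set.indicator_of_mem (hx.2 hxA)]
    · rw [Set.indicator_of_notMem hxA, Set.indicator_of_notMem (fun h => hxA (hx.1 h))]
  · rintro f g - hf hg ⟨φ, hφ, h1⟩ ⟨ψ, hψ, h2⟩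
    refine ⟨φ + ψ, hφ.add hψ, fun δ => ?_⟩
    filter_upwards [h1 δ, h2 δ] with x hx1 hx2
    rw [Pi.add_apply, Pi.add_apply, hx1, hx2]
  · rintro f hf - h
    choose φ hφ h using h
    refine ⟨fun y => ⨆ n, φ n y, Measurable.iSup hφ, fun δ => ?_⟩
    filter_upwards [ae_all_iff.2 fun n => h n δ] with x hx
    exact iSup_congr hx

theorem exists_map_eq_withDensity (hη : IsConjInvariant η)
    (htree : ∀ᵐ K ∂(η : Measure (Subgroup F₂)), TreeLike K) {g : F₂} (hg : g⁻¹ ∈ gens) :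
    ∃ φ : B.carrier → ℝ≥0∞, Measurable φ ∧
      (∀ᵐ x ∂(pathLaw η), φ (B.bnd x) = edgeDensity g⁻¹ x) ∧
      B.measure.map (fun y => g⁻¹ • y) = B.measure.withDensity φ := by
  obtain ⟨φ, hφ, h⟩ := B.exists_factor (measurable_edgeDensity_invariants g⁻¹)
  have h1 : ∀ᵐ x ∂(pathLaw η), φ (B.bnd x) = edgeDensity g⁻¹ x := by simpa using h 1
  refine ⟨φ, hφ, h1, ?_⟩
  ext E hE
  obtain ⟨A, hA, hAE⟩ := B.preimage_invariant E hE
  have hA1 : ∀ᵐ x ∂(pathLaw η), (B.bnd x ∈ E ↔ x ∈ A) := by simpa using hAE 1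
  have hsm : ∀ᵐ x ∂(pathLaw η), B.bnd (g⁻¹ • x) = g⁻¹ • B.bnd x := by simpa using B.bnd_smul g⁻¹ 1
  have lhs : B.measure.map (fun y => g⁻¹ • y) E = (pathLaw η).map (fun x => g⁻¹ • x) A := by
    rw [Measure.map_apply (B.measurable_smul _) hE, PoissonBoundary.measure,
      Measure.map_apply B.measurable_bnd (B.measurable_smul _ hE),
      Measure.map_apply (measurable_smul_cosetPath _) hA.1]
    refine measure_congr ?_
    -- The identification of `E` with `A` is needed along the translate by `g⁻¹`; the almost sure
    -- statement for `pathLaw η` alone would not give it, which is why negligible sets are tested on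
    -- all translates.
    filter_upwards [hsm, hAE g⁻¹] with x hx hx'
    refine propext ?_
    change g⁻¹ • B.bnd x ∈ E ↔ g⁻¹ • x ∈ A
    rw [← hx, hx']
  rw [lhs, map_smul_pathLaw_apply hη htree hg hA, withDensity_apply _ hE,
    ← lintegral_indicator hA.1, ← lintegral_indicator hE, PoissonBoundary.measure,
    lintegral_map (hφ.indicator hE) B.measurable_bnd]
  refine lintegral_congr_ae ?_
  filter_upwards [h1, hA1] with x hx hx'
  by_cases hxA : x ∈ A
  · rw [Set.indicator_of_mem hxA, Set.indicator_of_mem (hx'.2 hxA), hx]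
  · rw [Set.indicator_of_notMem hxA, Set.indicator_of_notMem (fun h => hxA (hx'.1 h))]

end PoissonBoundary

theorem abs_log_toReal_le {y : ℝ≥0∞} (h1 : 4⁻¹ ≤ y) (h2 : y ≤ 4) :
    |Real.log y.toReal| ≤ Real.log 4 := by
  have hy : y ≠ ∞ := (h2.trans_lt (by norm_num)).ne
  have h1' : (4 : ℝ)⁻¹ ≤ y.toReal := by
    simpa using ENNReal.toReal_mono hy h1
  have h2' : y.toReal ≤ 4 := by
    simpa using ENNReal.toReal_mono (by norm_num) h2
  have hpos : 0 < y.toReal := lt_of_lt_of_le (by norm_num) h1'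
  rw [abs_le]
  constructor
  · rw [← Real.log_inv]
    exact Real.log_le_log (by norm_num) h1'
  · exact Real.log_le_log hpos h2'

theorem integrable_log_edgeDensity (η : ProbabilityMeasure (Subgroup F₂)) {s : F₂}
    (hs : s ∈ gens) :
    Integrable (fun x => -Real.log (edgeDensity s x).toReal) (pathLaw η) := by
  refine Integrable.of_bound
    (measurable_edgeDensity s).ennreal_toReal.log.neg.aestronglyMeasurable (Real.log 4)
    (Eventually.of_forall fun x => ?_)
  rw [norm_neg]
  exact abs_log_toReal_le (quarter_le_edgeDensity hs x) (edgeDensity_le_four hs x)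

namespace PoissonBoundary

universe u

variable {η : ProbabilityMeasure (Subgroup F₂)} (B : PoissonBoundary.{u} η)

theorem entropyIntegrand_spec (hη : IsConjInvariant η)
    (htree : ∀ᵐ K ∂(η : Measure (Subgroup F₂)), TreeLike K) {g : F₂} (hg : g⁻¹ ∈ gens) :
    B.measure.map (fun y => g⁻¹ • y) ≪ B.measure ∧
      Integrable (entropyIntegrand B.measure g) B.measure ∧
      ∫ y, entropyIntegrand B.measure g y ∂B.measure
        = ∫ x, -Real.log (edgeDensity g⁻¹ x).toReal ∂(pathLaw η) := by
  obtain ⟨φ, hφ, h1, h2⟩ := B.exists_map_eq_withDensity hη htree hg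
  have hr : entropyIntegrand B.measure g =ᵐ[B.measure] fun y => -Real.log (φ y).toReal := by
    unfold entropyIntegrand
    rw [h2]
    filter_upwards [Measure.rnDeriv_withDensity B.measure hφ] with y hy
    rw [hy]
  have hm : Measurable fun y => -Real.log (φ y).toReal := hφ.ennreal_toReal.log.neg
  have hc : (fun x => -Real.log (φ (B.bnd x)).toReal)
      =ᵐ[pathLaw η] fun x => -Real.log (edgeDensity g⁻¹ x).toReal := by
    filter_upwards [h1] with x hx
    rw [hx]
  refine ⟨h2 ▸ withDensity_absolutelyContinuous _ _, ?_, ?_⟩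
  · rw [integrable_congr hr, PoissonBoundary.measure,
      integrable_map_measure hm.aestronglyMeasurable B.measurable_bnd.aemeasurable]
    exact (integrable_log_edgeDensity η hg).congr hc.symm
  · rw [integral_congr_ae hr, PoissonBoundary.measure,
      integral_map B.measurable_bnd.aemeasurable hm.aestronglyMeasurable]
    exact integral_congr_ae hc

end PoissonBoundary

/-! ### The entropy integral in terms of hitting probabilities. -/

/-- The probability that the walk on `K \ G` started at `K` is eventually on the side of `K s` of
the edge `{K, K s}`. -/
noncomputable def branchProb (s : F₂) (K : Subgroup F₂) : ℝ :=
  incrementLaw.real {X | cosetWalk (K, X) ∈ branchEvent s}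

/-- The contribution of the edge `{K, K s}` to the entropy, in terms of the hitting probabilities
between its ends and the probability of ending on the side of `K s`. -/
noncomputable def edgeEntropy (s : F₂) (K : Subgroup F₂) : ℝ :=
  branchProb s K * Real.log (hitProb 1 s K).toReal
    - (1 - branchProb s K) * Real.log (hitProb s 1 K).toReal

theorem measurable_branchProb (s : F₂) : Measurable (branchProb s) :=
  (measurable_measure_prodMk_left
    (measurable_cosetWalk (measurableSet_branchEvent s))).ennreal_toReal

theorem measurable_edgeEntropy (s : F₂) : Measurable (edgeEntropy s) :=
  ((measurable_branchProb s).mul (measurable_hitProb 1 s).ennreal_toReal.log).sub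
    (((measurable_const.sub (measurable_branchProb s))).mul
      (measurable_hitProb s 1).ennreal_toReal.log)

/-- For fixed `K` the density takes only two values, according to whether the walk ends in the
branch, so the integral over the increments is a two-term sum. -/
theorem integral_log_edgeDensity (η : ProbabilityMeasure (Subgroup F₂)) {s : F₂}
    (hs : s ∈ gens) :
    ∫ x, -Real.log (edgeDensity s x).toReal ∂(pathLaw η)
      = ∫ K, edgeEntropy s K ∂(η : Measure (Subgroup F₂)) := by
  have hm : Measurable fun x => -Real.log (edgeDensity s x).toReal :=
    (measurable_edgeDensity s).ennreal_toReal.log.neg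
  have hint := integrable_log_edgeDensity η hs
  rw [pathLaw, integrable_map_measure hm.aestronglyMeasurable
    measurable_cosetWalk.aemeasurable] at hint
  rw [pathLaw, integral_map measurable_cosetWalk.aemeasurable hm.aestronglyMeasurable,
    integral_prod (fun p => -Real.log (edgeDensity s (cosetWalk p)).toReal) hint]
  refine integral_congr_ae (Eventually.of_forall fun K => ?_)
  have hE : MeasurableSet {X | cosetWalk (K, X) ∈ branchEvent s} :=
    (measurable_cosetWalk.comp (measurable_prodMk_incr K)) (measurableSet_branchEvent s)
  have hsplit : (fun X => -Real.log (edgeDensity s (cosetWalk (K, X))).toReal)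
      = fun X => {X | cosetWalk (K, X) ∈ branchEvent s}.indicator
          (fun _ => Real.log (hitProb 1 s K).toReal) X
        + {X | cosetWalk (K, X) ∈ branchEvent s}ᶜ.indicator
          (fun _ => -Real.log (hitProb s 1 K).toReal) X := by
    funext X
    by_cases hX : X ∈ {X | cosetWalk (K, X) ∈ branchEvent s}
    · rw [Set.indicator_of_mem hX, Set.indicator_of_notMem (Set.notMem_compl_iff.2 hX),
        show edgeDensity s (cosetWalk (K, X)) = (hitProb 1 s K)⁻¹ from if_pos hX,
        ENNReal.toReal_inv, Real.log_inv]
      ring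
    · rw [Set.indicator_of_notMem hX, Set.indicator_of_mem hX,
        show edgeDensity s (cosetWalk (K, X)) = hitProb s 1 K from if_neg hX]
      ring
  dsimp only
  rw [hsplit, integral_add ((integrable_const _).indicator hE)
    ((integrable_const _).indicator hE.compl), integral_indicator_const _ hE,
    integral_indicator_const _ hE.compl, probReal_compl_eq_one_sub hE, edgeEntropy, branchProb,
    smul_eq_mul, smul_eq_mul]
  ring

/-! ### Finite-time approximations -/

/-- Needed to apply dominated convergence through `continuous_of_dominated`. -/
instance : FirstCountableTopology (Subgroup F₂) :=
  TopologicalSpace.firstCountableTopology_induced _ _ subgroupIndicator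

/-- For each fixed sequence of increments the indicator is locally constant in `K`; dominated
convergence then gives continuity of the probability. -/
theorem continuous_incrementLaw_real {U : Subgroup F₂ → Set (ℕ → F₂)}
    (hU : ∀ K, MeasurableSet (U K)) (hc : ∀ X, IsClopen {K | X ∈ U K}) :
    Continuous fun K => incrementLaw.real (U K) := by
  have h : (fun K => incrementLaw.real (U K))
      = fun K => ∫ X, (U K).indicator (fun _ => (1 : ℝ)) X ∂incrementLaw := by
    funext K
    rw [integral_indicator_const _ (hU K), smul_eq_mul, mul_one]
  rw [h]
  refine continuous_of_dominated (bound := fun _ => 1)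
    (fun K => (measurable_const.indicator (hU K)).aestronglyMeasurable)
    (fun K => Eventually.of_forall fun X => ?_) (integrable_const _)
    (Eventually.of_forall fun X => ?_)
  · exact (norm_indicator_le_norm_self _ _).trans (by simp)
  · exact (hc X).continuous_indicator (continuous_const (y := (1 : ℝ)))

/-- The probability that the walk on `K \ G` started at `K u` visits `K v` up to time `N`. -/
noncomputable def hitProbUpTo (N : ℕ) (u v : F₂) (K : Subgroup F₂) : ℝ :=
  incrementLaw.real {X | ∃ n, n ≤ N ∧ u * walk X n * v⁻¹ ∈ K}

/-- The probability that the walk on `K \ G` started at `K` is at time `n` at a vertex which can be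
reached from `K s` in `n` steps without using the edge `{K, K s}`. -/
noncomputable def branchProbAt (n : ℕ) (s : F₂) (K : Subgroup F₂) : ℝ :=
  incrementLaw.real {X | walk X n ∈ branchLevel K s n}

/-- The finite-time approximation of `edgeEntropy`. -/
noncomputable def edgeEntropyAt (n : ℕ) (s : F₂) (K : Subgroup F₂) : ℝ :=
  branchProbAt n s K * Real.log (hitProbUpTo (n + 1) 1 s K)
    - (1 - branchProbAt n s K) * Real.log (hitProbUpTo (n + 1) s 1 K)

theorem continuous_hitProbUpTo (N : ℕ) (u v : F₂) : Continuous (hitProbUpTo N u v) := by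
  refine continuous_incrementLaw_real (fun K => ?_) fun X => ?_
  · have : {X : ℕ → F₂ | ∃ n, n ≤ N ∧ u * walk X n * v⁻¹ ∈ K}
        = ⋃ n : ℕ, ⋃ _ : n ≤ N, {X | walk X n ∈ {g | u * g * v⁻¹ ∈ K}} := by ext X; simp
    rw [this]
    exact MeasurableSet.iUnion fun n => MeasurableSet.iUnion fun _ => measurableSet_walk_mem n _
  · have : {K : Subgroup F₂ | X ∈ {X : ℕ → F₂ | ∃ n, n ≤ N ∧ u * walk X n * v⁻¹ ∈ K}}
        = ⋃ n ∈ Set.Iic N, {K | u * walk X n * v⁻¹ ∈ K} := by ext K; simp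
    rw [this]
    exact (Set.finite_Iic N).isClopen_biUnion fun n _ => isClopen_mem _

theorem continuous_branchProbAt (n : ℕ) (s : F₂) : Continuous (branchProbAt n s) :=
  continuous_incrementLaw_real (fun _ => measurableSet_walk_mem n _)
    fun X => isClopen_mem_branchLevel s (walk X n) n

theorem quarter_le_measureReal {S : Set (ℕ → F₂)} (h : 4⁻¹ ≤ incrementLaw S) :
    4⁻¹ ≤ incrementLaw.real S := by
  simpa [Measure.real] using ENNReal.toReal_mono (measure_ne_top incrementLaw S) h

/-- The time bound `n + 1` always allows one step, which makes the lower bound valid even for `n =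
0` and keeps the logarithms continuous. -/
theorem quarter_le_hitProbUpTo {u v : F₂} (h : u⁻¹ * v ∈ gens) (n : ℕ) (K : Subgroup F₂) :
    4⁻¹ ≤ hitProbUpTo (n + 1) u v K := by
  refine quarter_le_measureReal
    ((quarter_le_measure_head h).trans (measure_mono fun X hX => ⟨1, by omega, ?_⟩))
  rw [walk_one, show X 0 = u⁻¹ * v from hX]
  simp

theorem quarter_le_hitProb_toReal {u v : F₂} (h : u⁻¹ * v ∈ gens) (K : Subgroup F₂) :
    4⁻¹ ≤ (hitProb u v K).toReal :=
  quarter_le_measureReal (quarter_le_hitProb h K)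

theorem hitProb_toReal_le_one (u v : F₂) (K : Subgroup F₂) : (hitProb u v K).toReal ≤ 1 :=
  measureReal_le_one

theorem continuous_edgeEntropyAt {s : F₂} (hs : s ∈ gens) (n : ℕ) :
    Continuous (edgeEntropyAt n s) := by
  have h1 : ∀ K, hitProbUpTo (n + 1) 1 s K ≠ 0 := fun K =>
    (lt_of_lt_of_le (by norm_num) (quarter_le_hitProbUpTo (by simpa using hs) n K)).ne'
  have h2 : ∀ K, hitProbUpTo (n + 1) s 1 K ≠ 0 := fun K =>
    (lt_of_lt_of_le (by norm_num)
      (quarter_le_hitProbUpTo (by simpa using inv_mem_gens hs) n K)).ne'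
  exact ((continuous_branchProbAt n s).mul ((continuous_hitProbUpTo _ _ _).log h1)).sub
    ((continuous_const.sub (continuous_branchProbAt n s)).mul
      ((continuous_hitProbUpTo _ _ _).log h2))

/-! ### Elementary estimates for logarithms and probabilities. -/

theorem abs_log_le_three {x : ℝ} (h1 : 4⁻¹ ≤ x) (h2 : x ≤ 1) : |Real.log x| ≤ 3 := by
  have hx : 0 < x := lt_of_lt_of_le (by norm_num) h1
  rw [abs_of_nonpos (Real.log_nonpos hx.le h2), ← Real.log_inv]
  have h3 : x⁻¹ ≤ 4 := inv_le_of_inv_le₀ (by norm_num) h1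
  linarith [Real.log_le_sub_one_of_pos (inv_pos.2 hx)]

theorem log_sub_log_le {x y : ℝ} (hx : 4⁻¹ ≤ x) (hy : 4⁻¹ ≤ y) :
    Real.log x - Real.log y ≤ 4 * |x - y| := by
  have hx0 : 0 < x := lt_of_lt_of_le (by norm_num) hx
  have hy0 : 0 < y := lt_of_lt_of_le (by norm_num) hy
  rw [← Real.log_div hx0.ne' hy0.ne']
  refine (Real.log_le_sub_one_of_pos (div_pos hx0 hy0)).trans ?_
  rw [div_sub_one hy0.ne', div_le_iff₀ hy0]
  nlinarith [le_abs_self (x - y), abs_nonneg (x - y)]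

theorem abs_log_sub_log_le {x y : ℝ} (hx : 4⁻¹ ≤ x) (hy : 4⁻¹ ≤ y) :
    |Real.log x - Real.log y| ≤ 4 * |x - y| := by
  refine abs_le.2 ⟨?_, log_sub_log_le hx hy⟩
  have := log_sub_log_le hy hx
  rw [abs_sub_comm] at this
  linarith

theorem abs_mul_log_sub_le {p q x y R : ℝ} (hq : 0 ≤ q) (hq' : q ≤ 1) (hx : 4⁻¹ ≤ x)
    (hx' : x ≤ 1) (hy : 4⁻¹ ≤ y) (hpq : |p - q| ≤ R) (hxy : |x - y| ≤ 4 * R) :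
    -- The constant is 3 + 4 · 4: the bound 3 on the logarithm, and the Lipschitz constant 4 of the
    -- logarithm on [1/4, ∞) times the factor 4 in `hxy`.
    |p * Real.log x - q * Real.log y| ≤ 19 * R := by
  have h : p * Real.log x - q * Real.log y
      = (p - q) * Real.log x + q * (Real.log x - Real.log y) := by ring
  rw [h]
  refine (abs_add_le _ _).trans ?_
  rw [abs_mul, abs_mul, abs_of_nonneg hq]
  have h1 : |p - q| * |Real.log x| ≤ R * 3 :=
    mul_le_mul hpq (abs_log_le_three hx hx') (abs_nonneg _) ((abs_nonneg _).trans hpq)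
  have h2 : q * |Real.log x - Real.log y| ≤ 1 * (4 * |x - y|) :=
    mul_le_mul hq' (abs_log_sub_log_le hx hy) (abs_nonneg _) zero_le_one
  linarith

theorem abs_measureReal_sub_le {α : Type*} [MeasurableSpace α] (P : Measure α)
    [IsFiniteMeasure P] {S T V : Set α} (h : ∀ᵐ x ∂P, x ∉ V → (x ∈ S ↔ x ∈ T)) :
    |P.real S - P.real T| ≤ P.real V := by
  have key : ∀ S T : Set α, (∀ᵐ x ∂P, x ∉ V → (x ∈ S ↔ x ∈ T)) →
      P.real S ≤ P.real T + P.real V := by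
    intro S T h
    refine le_trans ?_ (measureReal_union_le T V)
    refine ENNReal.toReal_mono (measure_ne_top _ _) (measure_mono_ae ?_)
    filter_upwards [h] with x hx hxS
    by_cases hV : x ∈ V
    · exact Or.inr hV
    · exact Or.inl ((hx hV).1 hxS)
  rw [abs_le]
  constructor
  · linarith [key T S (h.mono fun x hx hV => (hx hV).symm)]
  · linarith [key S T h]

theorem quarter_mul_le_returnProbGE {V : Set (ℕ → F₂)} {K : Subgroup F₂} {N : ℕ}
    (h : 4⁻¹ * incrementLaw V ≤ incrementLaw {X | ∃ m, N ≤ m ∧ walk X m ∈ K}) :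
    incrementLaw.real V ≤ 4 * returnProbGE N K := by
  have := ENNReal.toReal_mono (measure_ne_top _ _) h
  rw [ENNReal.toReal_mul] at this
  simp only [ENNReal.toReal_inv, ENNReal.toReal_ofNat] at this
  change 4⁻¹ * incrementLaw.real V ≤ returnProbGE N K at this
  linarith

/-- At the first visit to `K s` after time `N`, the next increment is `s⁻¹` with probability at
least 1/4, and this brings the walk back to `K`. -/
theorem measure_hit_after_right_le {s : F₂} (hs : s ∈ gens) (N : ℕ) (K : Subgroup F₂) :
    incrementLaw.real {X | ∃ m, N < m ∧ 1 * walk X m * s⁻¹ ∈ K} ≤ 4 * returnProbGE N K := by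
  refine quarter_mul_le_returnProbGE ?_
  let W : ℕ → Set F₂ := fun m => {g | N < m ∧ 1 * g * s⁻¹ ∈ K}
  have hD : MeasurableSet {X : ℕ → F₂ | X 0 = s⁻¹} :=
    (measurable_pi_apply (X := fun _ : ℕ => F₂) 0) (measurableSet_singleton s⁻¹)
  have key := strong_markov W hD
  rw [mul_comm] at key
  calc 4⁻¹ * incrementLaw (hitSet W)
      ≤ incrementLaw {X : ℕ → F₂ | X 0 = s⁻¹} * incrementLaw (hitSet W) := by
        gcongr; exact quarter_le_measure_head (inv_mem_gens hs)
    _ ≤ _ := by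
      rw [← key]
      refine measure_mono (Set.iUnion_subset fun m X hX => ⟨m + 1, ?_, ?_⟩)
      · have : N < m := hX.1.1.1
        omega
      · have h1 : 1 * walk X m * s⁻¹ ∈ K := hX.1.1.2
        have h2 : X (m + 0) = s⁻¹ := hX.2
        rw [add_zero] at h2
        rw [walk, h2]
        simpa using h1

/-- The walk from `K` takes `s` as its first step with probability at least 1/4 and then continues
as a walk from `K s`; a late visit of the latter to `K` is a late return of the former. -/
theorem measure_hit_after_left_le {s : F₂} (hs : s ∈ gens) (N : ℕ) (K : Subgroup F₂) :
    incrementLaw.real {X | ∃ m, N < m ∧ s * walk X m * 1⁻¹ ∈ K} ≤ 4 * returnProbGE N K := by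
  refine quarter_mul_le_returnProbGE ?_
  -- This target encodes the deterministic time 1, so that `strong_markov` yields the simple Markov
  -- property after a first step `s`.
  let W : ℕ → Set F₂ := fun m => {g | m = 1 ∧ g = s}
  let V : ℕ → Set F₂ := fun m => {g | N < m ∧ s * g * 1⁻¹ ∈ K}
  have key := strong_markov W (measurableSet_hitSet V)
  have hW : {X : ℕ → F₂ | X 0 = s} ⊆ hitSet W := fun X hX =>
    ⟨1, rfl, by rw [walk_one]; exact hX⟩
  calc 4⁻¹ * incrementLaw (hitSet V)
      ≤ incrementLaw (hitSet W) * incrementLaw (hitSet V) := by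
        gcongr; exact (quarter_le_measure_head hs).trans (measure_mono hW)
    _ ≤ _ := by
      rw [← key]
      refine measure_mono (Set.iUnion_subset fun m X hX => ?_)
      obtain ⟨⟨⟨rfl, hw⟩, -⟩, k, hk, hmem⟩ := hX
      refine ⟨1 + k, by omega, ?_⟩
      rw [walk_add, hw]
      simpa using hmem

theorem abs_hitProb_sub_le {u v : F₂} {K : Subgroup F₂} {n : ℕ} {R : ℝ}
    (h : incrementLaw.real {X | ∃ m, n + 1 < m ∧ u * walk X m * v⁻¹ ∈ K} ≤ R) :
    |(hitProb u v K).toReal - hitProbUpTo (n + 1) u v K| ≤ R := by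
  refine (abs_measureReal_sub_le incrementLaw (Eventually.of_forall fun X hX => ?_)).trans h
  refine ⟨fun ⟨m, hm⟩ => ⟨m, ?_, hm⟩, fun ⟨m, _, hm⟩ => ⟨m, hm⟩⟩
  by_contra! hlt
  exact hX ⟨m, hlt, hm⟩

theorem returnProbGE_anti (K : Subgroup F₂) {m n : ℕ} (h : m ≤ n) :
    returnProbGE n K ≤ returnProbGE m K :=
  measureReal_mono fun _ ⟨k, hk, hK⟩ => ⟨k, h.trans hk, hK⟩

/-- Each crossing of the edge has `K` as an endpoint. Without a visit to `K` from time `n` on, the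
side is thus decided at time `n`, where `walk_mem_branchLevel` makes it a finite condition. -/
theorem abs_branchProb_sub_le {K : Subgroup F₂} (hK : TreeLike K) {s : F₂} (hs : s ∈ gens)
    (hsK : s ∉ K) (n : ℕ) : |branchProb s K - branchProbAt n s K| ≤ returnProbGE n K := by
  refine abs_measureReal_sub_le incrementLaw ?_
  filter_upwards [ae_forall_mem_gens] with X hX hV
  have hV' : ∀ m, n ≤ m → walk X m ∉ K := fun m hm h => hV ⟨m, hm, h⟩
  have hstay := walk_mem_branch_iff (K := K) (s := s) (u := 1) hX (N := n) (fun m hm hc =>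
    hc.hits_left.elim (by simpa using hV' m hm) (by simpa using hV' (m + 1) (by omega)))
  simp only [one_mul] at hstay
  have hev : cosetWalk (K, X) ∈ branchEvent s ↔ walk X n ∈ branch K s := by
    rw [← cosetWalkFrom_one, cosetWalkFrom_mem_branchEvent]
    simp only [one_mul]
    refine ⟨fun ⟨N, hN⟩ => ?_, fun h => ⟨n, fun m hm => (hstay m hm).2 h⟩⟩
    exact (hstay (max n N) (le_max_left _ _)).1 (hN _ (le_max_right _ _))
  exact hev.trans ⟨walk_mem_branchLevel hK hs hsK hX n, fun h => ⟨n, h⟩⟩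

/-- The constant is 2 · 19, one application of `abs_mul_log_sub_le` for each of the two terms. -/
theorem abs_edgeEntropy_sub_le {K : Subgroup F₂} (hK : TreeLike K) {s : F₂} (hs : s ∈ gens)
    (n : ℕ) : |edgeEntropy s K - edgeEntropyAt n s K| ≤ 38 * returnProbGE n K := by
  have hR : 0 ≤ returnProbGE n K := measureReal_nonneg
  by_cases hsK : s ∈ K
  -- For a loop all four hitting probabilities are 1, so both entropies vanish.
  · have h1 : ∀ u v : F₂, u * v⁻¹ ∈ K → hitProbUpTo (n + 1) u v K = 1 := by
      intro u v h
      have : {X : ℕ → F₂ | ∃ m, m ≤ n + 1 ∧ u * walk X m * v⁻¹ ∈ K} = Set.univ :=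
        Set.eq_univ_of_forall fun X => ⟨0, by omega, by simpa [walk] using h⟩
      rw [hitProbUpTo, this, probReal_univ]
    rw [edgeEntropy, edgeEntropyAt, hitProb_eq_one (by simpa using hsK),
      hitProb_eq_one (by simpa using hsK), h1 1 s (by simpa using hsK),
      h1 s 1 (by simpa using hsK)]
    simpa using hR
  · have hb := abs_branchProb_sub_le hK hs hsK n
    have hb' : |(1 - branchProb s K) - (1 - branchProbAt n s K)| ≤ returnProbGE n K := by
      rw [← abs_neg]
      convert hb using 2
      ring
    have hanti := returnProbGE_anti K (Nat.le_succ n)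
    have g1 : (1 : F₂)⁻¹ * s ∈ gens := by simpa using hs
    have g2 : s⁻¹ * 1 ∈ gens := by simpa using inv_mem_gens hs
    have h0 : 0 ≤ branchProbAt n s K := measureReal_nonneg
    have h1 : branchProbAt n s K ≤ 1 := measureReal_le_one
    have i1 := abs_mul_log_sub_le h0 h1 (quarter_le_hitProb_toReal g1 K)
      (hitProb_toReal_le_one 1 s K) (quarter_le_hitProbUpTo g1 n K) hb
      (abs_hitProb_sub_le ((measure_hit_after_right_le hs (n + 1) K).trans (by linarith)))
    have i2 := abs_mul_log_sub_le (sub_nonneg.2 h1) (sub_le_self 1 h0)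
      (quarter_le_hitProb_toReal g2 K)
      (hitProb_toReal_le_one s 1 K) (quarter_le_hitProbUpTo g2 n K) hb'
      (abs_hitProb_sub_le ((measure_hit_after_left_le hs (n + 1) K).trans (by linarith)))
    rw [edgeEntropy, edgeEntropyAt, sub_sub_sub_comm]
    refine (abs_sub _ _).trans ?_
    linarith

/-! ### Continuity of the entropy -/

theorem abs_mul_log_sub_mul_log_le {p x y : ℝ} (hp : 0 ≤ p) (hp' : p ≤ 1) (hx : 4⁻¹ ≤ x)
    (hx' : x ≤ 1) (hy : 4⁻¹ ≤ y) (hy' : y ≤ 1) :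
    |p * Real.log x - (1 - p) * Real.log y| ≤ 3 := by
  refine (abs_sub _ _).trans ?_
  rw [abs_mul, abs_mul, abs_of_nonneg hp, abs_of_nonneg (sub_nonneg.2 hp')]
  nlinarith [abs_log_le_three hx hx', abs_log_le_three hy hy']

theorem abs_edgeEntropy_le {s : F₂} (hs : s ∈ gens) (K : Subgroup F₂) : |edgeEntropy s K| ≤ 3 :=
  abs_mul_log_sub_mul_log_le measureReal_nonneg measureReal_le_one
    (quarter_le_hitProb_toReal (by simpa using hs) K) (hitProb_toReal_le_one _ _ K)
    (quarter_le_hitProb_toReal (by simpa using inv_mem_gens hs) K) (hitProb_toReal_le_one _ _ K)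

theorem abs_edgeEntropyAt_le {s : F₂} (hs : s ∈ gens) (n : ℕ) (K : Subgroup F₂) :
    |edgeEntropyAt n s K| ≤ 3 :=
  abs_mul_log_sub_mul_log_le measureReal_nonneg measureReal_le_one
    (quarter_le_hitProbUpTo (by simpa using hs) n K) measureReal_le_one
    (quarter_le_hitProbUpTo (by simpa using inv_mem_gens hs) n K) measureReal_le_one

theorem continuous_integral_edgeEntropyAt {s : F₂} (hs : s ∈ gens) (n : ℕ) :
    Continuous fun η : ProbabilityMeasure (Subgroup F₂) =>
      ∫ K, edgeEntropyAt n s K ∂(η : Measure (Subgroup F₂)) :=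
  ProbabilityMeasure.continuous_integral_boundedContinuousFunction
    (BoundedContinuousFunction.ofNormedAddCommGroup (edgeEntropyAt n s)
      (continuous_edgeEntropyAt hs n) 3 (abs_edgeEntropyAt_le hs n))

theorem measurable_returnProbGE (n : ℕ) : Measurable (returnProbGE n) := by
  have h : MeasurableSet {p : Subgroup F₂ × (ℕ → F₂) | ∃ m, n ≤ m ∧ walk p.2 m ∈ p.1} := by
    have : {p : Subgroup F₂ × (ℕ → F₂) | ∃ m, n ≤ m ∧ walk p.2 m ∈ p.1}
        = ⋃ m : ℕ, ⋃ _ : n ≤ m, {p | 1 * walk p.2 m * 1⁻¹ ∈ p.1} := by ext p; simp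
    rw [this]
    exact MeasurableSet.iUnion fun m => MeasurableSet.iUnion fun _ =>
      measurableSet_mul_walk_mem 1 1 m
  exact (measurable_measure_prodMk_left h).ennreal_toReal

theorem integrable_returnProbGE (η : ProbabilityMeasure (Subgroup F₂)) (n : ℕ) :
    Integrable (returnProbGE n) (η : Measure (Subgroup F₂)) := by
  refine Integrable.of_bound (measurable_returnProbGE n).aestronglyMeasurable 1
    (Eventually.of_forall fun K => ?_)
  have h0 : 0 ≤ returnProbGE n K := measureReal_nonneg
  rw [Real.norm_of_nonneg h0]
  exact measureReal_le_one

/-- Split at the level `δ` and use that return probabilities are at most 1. This turns control in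
measure into control in mean. -/
theorem integral_returnProbGE_le (η : ProbabilityMeasure (Subgroup F₂)) (n : ℕ) {δ : ℝ}
    (hδ : 0 ≤ δ) : ∫ K, returnProbGE n K ∂(η : Measure (Subgroup F₂))
      ≤ δ + (η : Measure (Subgroup F₂)).real {K | δ ≤ returnProbGE n K} := by
  have hS : MeasurableSet {K | δ ≤ returnProbGE n K} :=
    measurableSet_le measurable_const (measurable_returnProbGE n)
  have hi := (integrable_const (μ := (η : Measure (Subgroup F₂))) (1 : ℝ)).indicator hS
  calc ∫ K, returnProbGE n K ∂(η : Measure (Subgroup F₂))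
      ≤ ∫ K, (δ + {K | δ ≤ returnProbGE n K}.indicator (fun _ => (1 : ℝ)) K)
          ∂(η : Measure (Subgroup F₂)) := by
        refine integral_mono ?_ ((integrable_const _).add hi) fun K => ?_
        · exact integrable_returnProbGE η n
        · by_cases hK : K ∈ {K | δ ≤ returnProbGE n K}
          · dsimp only
            rw [Set.indicator_of_mem hK]
            have : returnProbGE n K ≤ 1 := measureReal_le_one
            linarith
          · dsimp only
            rw [Set.indicator_of_notMem hK, add_zero]
            exact (not_le.1 hK).le
    _ = _ := by
        rw [integral_add (integrable_const _) hi, integral_indicator_const _ hS]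
        simp

theorem continuous_integral_edgeEntropy {𝒩 : Set (ProbabilityMeasure (Subgroup F₂))}
    (htree : ∀ η ∈ 𝒩, ∀ᵐ K ∂(η : Measure (Subgroup F₂)), TreeLike K)
    (hret : ControlledReturnTimes 𝒩) {s : F₂} (hs : s ∈ gens) :
    Continuous fun η : 𝒩 => ∫ K, edgeEntropy s K ∂(η.1 : Measure (Subgroup F₂)) := by
  have hunif : TendstoUniformly
      (fun n (η : 𝒩) => ∫ K, edgeEntropyAt n s K ∂(η.1 : Measure (Subgroup F₂)))
      (fun η : 𝒩 => ∫ K, edgeEntropy s K ∂(η.1 : Measure (Subgroup F₂))) atTop := by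
    rw [Metric.tendstoUniformly_iff]
    intro ε hε
    -- The final error is 38 · 2 · ε/100, which is below `ε`.
    have hδ : 0 < ε / 100 := by positivity
    have hev := (hret (ε / 100) hδ).eventually_lt_const (ENNReal.ofReal_pos.2 hδ)
    filter_upwards [hev] with n hn η
    have hη : (η.1 : Measure (Subgroup F₂)).real {K | ε / 100 ≤ returnProbGE n K} ≤ ε / 100 := by
      refine ENNReal.toReal_le_of_le_ofReal hδ.le (le_trans ?_ hn.le)
      exact le_iSup₂ (f := fun (η : ProbabilityMeasure (Subgroup F₂)) (_ : η ∈ 𝒩) =>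
        (η : Measure (Subgroup F₂)) {K | ε / 100 ≤ returnProbGE n K}) η.1 η.2
    have i1 : Integrable (edgeEntropy s) (η.1 : Measure (Subgroup F₂)) :=
      Integrable.of_bound (measurable_edgeEntropy s).aestronglyMeasurable 3
        (Eventually.of_forall (abs_edgeEntropy_le hs))
    have i2 : Integrable (edgeEntropyAt n s) (η.1 : Measure (Subgroup F₂)) :=
      Integrable.of_bound (continuous_edgeEntropyAt hs n).measurable.aestronglyMeasurable 3
        (Eventually.of_forall (abs_edgeEntropyAt_le hs n))
    rw [Real.dist_eq, ← integral_sub i1 i2]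
    calc |∫ K, (edgeEntropy s K - edgeEntropyAt n s K) ∂(η.1 : Measure (Subgroup F₂))|
        ≤ ∫ K, |edgeEntropy s K - edgeEntropyAt n s K| ∂(η.1 : Measure (Subgroup F₂)) :=
          abs_integral_le_integral_abs
      _ ≤ ∫ K, 38 * returnProbGE n K ∂(η.1 : Measure (Subgroup F₂)) := by
          refine integral_mono_ae (i1.sub i2).abs ((integrable_returnProbGE η.1 n).const_mul 38) ?_
          filter_upwards [htree η.1 η.2] with K hK
          exact abs_edgeEntropy_sub_le hK hs n
      _ ≤ 38 * (ε / 100 + ε / 100) := by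
          rw [integral_const_mul]
          have := integral_returnProbGE_le η.1 n hδ.le
          linarith
      _ < ε := by linarith
  exact hunif.continuous (Eventually.of_forall fun n =>
    (continuous_integral_edgeEntropyAt hs n).comp continuous_subtype_val).frequently

/-! ### Averaging over the generators. -/

theorem stepMeasure_restrict_gens : stepMeasure.restrict (gens : Set F₂) = stepMeasure :=
  Measure.restrict_eq_self_of_ae_mem ae_mem_gens

theorem integrable_stepMeasure (f : F₂ → ℝ) : Integrable f stepMeasure := by
  rw [← stepMeasure_restrict_gens]
  exact IntegrableOn.finset

theorem integral_stepMeasure (f : F₂ → ℝ) :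
    ∫ g, f g ∂stepMeasure = ∑ g ∈ gens, stepMeasure.real {g} * f g := by
  conv_lhs => rw [← stepMeasure_restrict_gens]
  exact setIntegral_finset _ IntegrableOn.finset

namespace PoissonBoundary

universe u

variable {η : ProbabilityMeasure (Subgroup F₂)} (B : PoissonBoundary.{u} η)

theorem furstenbergEntropyDefined (hη : IsConjInvariant η)
    (htree : ∀ᵐ K ∂(η : Measure (Subgroup F₂)), TreeLike K) :
    FurstenbergEntropyDefined stepMeasure B.measure := by
  refine ⟨?_, integrable_stepMeasure _⟩
  filter_upwards [ae_mem_gens] with g hg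
  have h := B.entropyIntegrand_spec hη htree (inv_mem_gens hg)
  exact ⟨h.1, h.2.1⟩

theorem furstenbergEntropy_eq (hη : IsConjInvariant η)
    (htree : ∀ᵐ K ∂(η : Measure (Subgroup F₂)), TreeLike K) :
    furstenbergEntropy stepMeasure B.measure
      = ∑ g ∈ gens, stepMeasure.real {g} *
        ∫ K, edgeEntropy g⁻¹ K ∂(η : Measure (Subgroup F₂)) := by
  rw [furstenbergEntropy, integral_stepMeasure]
  refine Finset.sum_congr rfl fun g hg => ?_
  rw [(B.entropyIntegrand_spec hη htree (inv_mem_gens hg)).2.2,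
    integral_log_edgeDensity η (inv_mem_gens hg)]

end PoissonBoundary

end RandomCosetWalk

theorem theorem4p1
    (𝒩 : Set (MeasureTheory.ProbabilityMeasure (Subgroup RandomCosetWalk.F₂)))
    (h_inv : ∀ η ∈ 𝒩, RandomCosetWalk.IsConjInvariant η)
    (h_tree : ∀ η ∈ 𝒩, ∀ᵐ K ∂(η : MeasureTheory.Measure (Subgroup RandomCosetWalk.F₂)),
      RandomCosetWalk.TreeLike K)
    (h_ret : RandomCosetWalk.ControlledReturnTimes 𝒩)
    (B : ∀ η : 𝒩, RandomCosetWalk.PoissonBoundary (η : MeasureTheory.ProbabilityMeasure _)) :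
    (∀ η : 𝒩, RandomCosetWalk.FurstenbergEntropyDefined RandomCosetWalk.stepMeasure
      (B η).measure) ∧
    Continuous fun η : 𝒩 =>
      RandomCosetWalk.furstenbergEntropy RandomCosetWalk.stepMeasure (B η).measure := by
  refine ⟨fun η => (B η).furstenbergEntropyDefined (h_inv η η.2) (h_tree η η.2), ?_⟩
  simp_rw [fun η : 𝒩 => (B η).furstenbergEntropy_eq (h_inv η η.2) (h_tree η η.2)]
  exact continuous_finsetSum _ fun g hg => continuous_const.mul
    (RandomCosetWalk.continuous_integral_edgeEntropy h_tree h_ret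
      (RandomCosetWalk.inv_mem_gens hg))
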